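/- Let $n\ge 1$. For $m\ge 0$ let $I_m=\{1,\dots,m\}$ be the index set of the Dynkin diagram $A_m$, let $W_m=\mathfrak S_{m+1}$ be its Weyl group with simple reflections $s_i=(i\ i{+}1)$ and longest element $w_0$ (the order-reversing permutation), and put $i^*=m+1-i$. Two words in the alphabet $I_m$ are commutation equivalent if one is obtained from the other by repeatedly interchanging consecutive letters $i,j$ with $|i-j|\ge 2$; $[\mathbf i]$ denotes the commutation class of $\mathbf i$. For a class $c$ of reduced words of $w_0$, an index $i$ is a sink (resp. source) of $c$ if some word of $c$ starts (resp. ends) with $i$. The reflection functors replace $c=[i\,i_2\cdots i_N]$ by $[i_2\cdots i_N\, i^*]$ for a sink $i$ (right action of $r_i$), and $c=[i_1\cdots i_{N-1}\,i]$ by $[i^*\,i_1\cdots i_{N-1}]$ for a source $i$ (left action of $r_i$); in the other cases $r_i$ fixes $c$. The $r$-cluster point $[\![c]\!]$ of $c$ is the set of all classes obtained from $c$ by sequences of reflection functors. A Dynkin quiver $Q$ of type $A_m$ is an orientation of the Dynkin diagram $A_m$; a sink of $Q$ is a vertex without outgoing arrows, and $i\,Q$ is obtained from $Q$ by reversing all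 arrows at the vertex $i$. A word $i_1\cdots i_l$ is adapted to $Q$ if $i_k$ is a sink of $i_{k-1}\cdots i_1Q$ for all $1\le k\le l$. The reduced words of $w_0$ adapted to $Q$ form one commutation class $[Q]$. The adapted cluster point $[\![Q]\!]$ of type $A_{2n}$ is the set of the classes $[Q']$ for all Dynkin quivers $Q'$ of type $A_{2n}$. The twisted adapted cluster point $[\![Q^\diamondsuit]\!]$ of type $A_{2n+1}$ is the $r$-cluster point of the class of $$\mathbf i_0=\prod_{k=0}^{2n}(1\,2\cdots n{+}1)^{k\vee},$$ where $\vee$ replaces each letter $i$ by $2n+2-i$ and $k\vee$ means $\vee$ applied $k$ times. Let $\mathbf P:\langle I_{2n+1}\rangle\to\langle I_{2n}\rangle$ be the homomorphism of free monoids with $\mathbf P(i)=i$ for $i\le n$, $\mathbf P(n+1)=$ the empty word, and $\mathbf P(j)=j-1$ for $j\ge n+2$. Then: 1. Every word in a class of $[\![Q^\diamondsuit]\!]$ is a reduced word of $w_0$ of type $A_{2n+1}$, and $[\![Q]\!]$ is the $r$-cluster point of each of its elements. 2. $[\![Q^\diamondsuit]\!]$ has exactly $2^{2n}$ elements. 3.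 Every class in $[\![Q^\diamondsuit]\!]$ has $n+1$ as a source or as a sink, but not both. 4. $[\mathbf i]\mapsto[\mathbf P(\mathbf i)]$ is a well-defined map $\mathbf P:[\![Q^\diamondsuit]\!]\to[\![Q]\!]$, which is onto and two-to-one: every element of $[\![Q]\!]$ has exactly two preimages. Exactly one of the two preimages has $n+1$ as a source, and exactly one has $n+1$ as a sink. In particular, for every Dynkin quiver $Q'$ of type $A_{2n}$ there is exactly one class with image $[Q']$ that has $n+1$ as a source, and exactly one that has $n+1$ as a sink. 5. Let $\mathbf i'$ be a reduced word of $w_0$ of type $A_{2n}$ adapted to a Dynkin quiver $Q'$. Replace each letter $i\ge n+1$ of $\mathbf i'$ by $i+1$, and then insert exactly one letter $n+1$ somewhere between any two letters of $\{n,n+2\}$ that are consecutive among the letters of $\{n,n+2\}$, and nowhere else. This is possible; the commutation class of the resulting word $\mathbf u$ does not depend on the choice of the positions, the classes $[(n{+}1)\,\mathbf u]$ and $[\mathbf u\,(n{+}1)]$ are distinct, and the set of preimages of $[\mathbf i']=[Q']$ under $\mathbf P$ is $\{[(n{+}1)\,\mathbf u],\,[\mathbf u\,(n{+}1)]\}$.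 -/

import Mathlib

/-! Combinatorics of reduced words of the longest element in type `A_m`.

The index set `I_m = {1, …, m}` of the Dynkin diagram `A_m` is modelled by `Fin m`, the index
`i` being the element of `Fin m` with value `i - 1`. The Weyl group is the symmetric group on
`m + 1` points. The involution `*` induced by the longest element is `i ↦ m + 1 - i`,
that is `Fin.rev`. -/

namespace TwistedAdapted

/-- Words in the alphabet `I_m`, i.e. elements of the free monoid on `I_m`. -/
abbrev Word (m : ℕ) := List (Fin m)

/-- `i` and `j` are joined by an edge of the Dynkin diagram of type `A_m`. -/
def DynkinAdj {m : ℕ} (i j : Fin m) : Prop :=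
  (i : ℕ) + 1 = j ∨ (j : ℕ) + 1 = i

instance {m : ℕ} (i j : Fin m) : Decidable (DynkinAdj i j) := by
  unfold DynkinAdj
  infer_instance

/-! ### The Weyl group and reduced words -/

/-- The simple reflection `s_i`, the transposition of `i` and `i + 1`. -/
def simpleRefl {m : ℕ} (i : Fin m) : Equiv.Perm (Fin (m + 1)) :=
  Equiv.swap i.castSucc i.succ

/-- The element of the Weyl group represented by a word. -/
def wordProd {m : ℕ} (w : Word m) : Equiv.Perm (Fin (m + 1)) :=
  (w.map simpleRefl).prod

/-- A word is reduced if no shorter word represents the same element. -/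
def IsReduced {m : ℕ} (w : Word m) : Prop :=
  ∀ v : Word m, wordProd v = wordProd w → w.length ≤ v.length

/-- `w` is a reduced word of the longest element `w₀` (the order-reversing permutation). -/
def IsLongestWord {m : ℕ} (w : Word m) : Prop :=
  IsReduced w ∧ wordProd w = Fin.revPerm

/-! ### Commutation classes -/

/-- One commutation relation: two consecutive letters `i`, `j` which are distinct and not joined
in the Dynkin diagram are interchanged. -/
inductive CommStep {m : ℕ} : Word m → Word m → Prop
  | swap (u v : Word m) (i j : Fin m) (hne : i ≠ j) (hij : ¬ DynkinAdj i j) :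
      CommStep (u ++ i :: j :: v) (u ++ j :: i :: v)

/-- Commutation equivalence of words. -/
def commSetoid (m : ℕ) : Setoid (Word m) :=
  Relation.EqvGen.setoid CommStep

/-- Commutation classes of words. -/
def CommClass (m : ℕ) : Type :=
  Quotient (commSetoid m)

/-- The commutation class `[w]` of a word. -/
def commClass {m : ℕ} (w : Word m) : CommClass m :=
  Quotient.mk (commSetoid m) w

/-- `i` is a sink of the class `c` if some word of `c` starts with `i`. -/
def IsSink {m : ℕ} (i : Fin m) (c : CommClass m) : Prop :=
  ∃ w : Word m, c = commClass (i :: w)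

/-- `i` is a source of the class `c` if some word of `c` ends with `i`. -/
def IsSource {m : ℕ} (i : Fin m) (c : CommClass m) : Prop :=
  ∃ w : Word m, c = commClass (w ++ [i])

/-! ### Reflection functors and `r`-cluster points -/

/-- `d` is obtained from `c` by the right action of a reflection functor `r_i`, `i` a sink of `c`,
or by the left action of a reflection functor `r_i`, `i` a source of `c`. (In the remaining
cases `r_i` acts as the identity.) -/
def ReflStep {m : ℕ} (c d : CommClass m) : Prop :=
  ∃ (i : Fin m) (w : Word m),
    (c = commClass (i :: w) ∧ d = commClass (w ++ [i.rev])) ∨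
    (c = commClass (w ++ [i]) ∧ d = commClass (i.rev :: w))

/-- The `r`-cluster point of `c`: all classes obtained from `c` by a sequence of
reflection functors. -/
def rCluster {m : ℕ} (c : CommClass m) : Set (CommClass m) :=
  {d | Relation.ReflTransGen ReflStep c d}

/-! ### Dynkin quivers and the adapted cluster point -/

/-- A Dynkin quiver of type `A_m`: an orientation of every edge of the Dynkin diagram. -/
@[ext]
structure DynkinQuiver (m : ℕ) where
  /-- there is an arrow `i → j` -/
  arrow : Fin m → Fin m → Prop
  adj_of_arrow : ∀ i j, arrow i j → DynkinAdj i j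
  oriented : ∀ i j, DynkinAdj i j → Xor (arrow i j) (arrow j i)

namespace DynkinQuiver

/-- A vertex is a sink of the quiver if no arrow exits out of it. -/
def IsSink {m : ℕ} (Q : DynkinQuiver m) (i : Fin m) : Prop :=
  ∀ j, ¬ Q.arrow i j

/-- The quiver `i Q`, with every arrow incident with `i` reversed. -/
def reflect {m : ℕ} (i : Fin m) (Q : DynkinQuiver m) : DynkinQuiver m where
  arrow a b := (a = i ∨ b = i) ∧ Q.arrow b a ∨ ¬ (a = i ∨ b = i) ∧ Q.arrow a b
  adj_of_arrow a b h := by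
    rcases h with h | h
    · exact (Q.adj_of_arrow b a h.2).symm
    · exact Q.adj_of_arrow a b h.2
  oriented a b h := by
    have h1 := Q.oriented a b h
    by_cases hab : a = i ∨ b = i
    · have hba : b = i ∨ a = i := hab.symm
      simpa only [hab, hba, true_and, not_true_eq_false, false_and, or_false] using (xor_comm _ _).mp h1
    · have hba : ¬ (b = i ∨ a = i) := fun k => hab k.symm
      simpa only [hab, hba, false_and, not_false_eq_true, true_and, false_or] using h1

/-- `i₁ i₂ ⋯ i_l` is adapted to `Q` if `i_k` is a sink of `i_{k-1} ⋯ i₂ i₁ Q` for all `k`. -/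
def Adapted {m : ℕ} : DynkinQuiver m → Word m → Prop
  | _, [] => True
  | Q, i :: w => Q.IsSink i ∧ Adapted (reflect i Q) w

/-- `c` is the commutation class `[Q]` of reduced words of `w₀` adapted to `Q`. -/
def IsClassOf {m : ℕ} (Q : DynkinQuiver m) (c : CommClass m) : Prop :=
  ∃ w : Word m, IsLongestWord w ∧ Q.Adapted w ∧ c = commClass w

end DynkinQuiver

/-- The adapted cluster point `⟦Q⟧` of type `A_m`: the classes `[Q']` of all Dynkin quivers
`Q'` of type `A_m`. -/
def adaptedCluster (m : ℕ) : Set (CommClass m) :=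
  {c | ∃ Q : DynkinQuiver m, Q.IsClassOf c}

/-! ### The twisted adapted cluster point -/

/-- The word `1 2 ⋯ n+1` in the alphabet `I_{2n+1}`. -/
def baseBlock (n : ℕ) : Word (2 * n + 1) :=
  List.ofFn fun j : Fin (n + 1) => (⟨j, by omega⟩ : Fin (2 * n + 1))

/-- The word `∏_{k=0}^{2n} (1 2 ⋯ n+1)^{k∨}`, where `∨` is applied letterwise and
`i^∨ = 2n+2-i`. -/
def baseWord (n : ℕ) : Word (2 * n + 1) :=
  ((List.range (2 * n + 1)).map fun k => (baseBlock n).map (Fin.rev^[k])).flatten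

/-- The twisted adapted cluster point of type `A_{2n+1}`. -/
def twistedCluster (n : ℕ) : Set (CommClass (2 * n + 1)) :=
  rCluster (commClass (baseWord n))

/-- The letter `n+1` of `I_{2n+1}`. -/
def mid (n : ℕ) : Fin (2 * n + 1) :=
  ⟨n, by omega⟩

/-- The map `P` on letters: `i ↦ i` for `i ≤ n`, `n+1 ↦` the empty word, and `j ↦ j-1` for
`j ≥ n+2`. -/
def letterP (n : ℕ) (j : Fin (2 * n + 1)) : Option (Fin (2 * n)) :=
  if h : (j : ℕ) < n then some ⟨j, by omega⟩
  else if h' : n < (j : ℕ) then some ⟨j - 1, by omega⟩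
  else none

/-- The monoid homomorphism `P` from words in `I_{2n+1}` to words in `I_{2n}`. -/
def wordP (n : ℕ) (w : Word (2 * n + 1)) : Word (2 * n) :=
  w.filterMap (letterP n)

/-- `u` is obtained from the word `w` in `I_{2n}` by replacing each letter `i ≥ n+1` by `i+1` and
then inserting exactly one letter `n+1` between any two letters of `{n, n+2}` which are
adjacent (consecutive among the letters of `{n, n+2}`), and nowhere else. -/
def IsInsertion (n : ℕ) (w : Word (2 * n)) (u : Word (2 * n + 1)) : Prop :=
  wordP n u = w ∧
  u.filter (fun j => decide (DynkinAdj j (mid n) ∨ j = mid n)) =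
    (u.filter (fun j => decide (DynkinAdj j (mid n)))).intersperse (mid n)

end TwistedAdapted

open TwistedAdapted

namespace TwistedAdapted
open Finset

/-! ### Inversions and reduced words -/

/-! Classes are encoded by states from which letters are fired. In type A_{2n} a state is a quiver
Q, and a letter can be fired when it is a sink. In type A_{2n+1} a state is a pair of a quiver Q of
type A_{2n} and a flag: letters other than n+1 fire as their images under P, and the flag forces n+1
to alternate with its neighbours n and n+2. `FiringSystem` isolates what both share: simultaneously
enabled letters commute and stay enabled until fired, and the diagram automorphism acts on states.

An enabled letter occurring in an adapted word can be moved to the front. Hence adapted words with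
the same letters, or adapted reduced words of the same element, are commutation equivalent, and a
state carries at most one class of adapted reduced words of w₀. A `Good` word moreover leads from x
to its dual state. Moving its first letter i to the end as i* gives a good word of the fired state
(`Good.rotate`), so reflection functors on classes are firings of states. One good word and
connectedness of the states under firing therefore identify each cluster with the set of all states.
The good word is the base word, or its image under P; connectedness is
`DynkinQuiver.reflTransGen_step`, lifted in `exists_good_twisted`.

Different states give different classes: the image under P remains a reduced word of w₀ under
rotation, so it determines Q, and the flag says whether n+1 is a sink. Thus P forgets the flag,
which gives the fibres and the count 2 · 2^(2n-1). An inserted word is adapted to (Q, false) because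
of its alternation; counting letters compares it, completed by one n+1 at either end, with a good
word. -/

/-- The set of inversions of a permutation. -/
def inversions {k : ℕ} (p : Equiv.Perm (Fin k)) : Finset (Fin k × Fin k) :=
  univ.filter fun ab => ab.1 < ab.2 ∧ p ab.2 < p ab.1

/-- The number of inversions of a permutation. -/
def inv {k : ℕ} (p : Equiv.Perm (Fin k)) : ℕ := (inversions p).card

lemma mem_inversions {k : ℕ} {p : Equiv.Perm (Fin k)} {a b : Fin k} :
    (a, b) ∈ inversions p ↔ a < b ∧ p b < p a := by
  simp [inversions]

/-- Exchanging two neighbouring values alters the relative order of that pair of values only. -/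
lemma simpleRefl_lt_iff {m : ℕ} (i : Fin m) {x y : Fin (m + 1)} (hxy : x ≠ y) :
    simpleRefl i y < simpleRefl i x ↔
      (x = i.castSucc ∧ y = i.succ) ∨ (y < x ∧ ¬ (y = i.castSucc ∧ x = i.succ)) := by
  unfold simpleRefl
  simp only [Equiv.swap_apply_def, Fin.ext_iff, Fin.lt_def, Fin.val_castSucc, Fin.val_succ]
  have : (x : ℕ) ≠ y := fun h => hxy (Fin.ext h)
  split_ifs <;> simp_all <;> omega

lemma simpleRefl_mul_self {m : ℕ} (i : Fin m) : simpleRefl i * simpleRefl i = 1 :=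
  Equiv.swap_mul_self _ _

lemma inv_simpleRefl_mul_of_lt {m : ℕ} (i : Fin m) (p : Equiv.Perm (Fin (m + 1)))
    (h : p.symm i.castSucc < p.symm i.succ) : inv (simpleRefl i * p) = inv p + 1 := by
  have hmem : (p.symm i.castSucc, p.symm i.succ) ∉ inversions p := by
    rw [mem_inversions, Equiv.apply_symm_apply, Equiv.apply_symm_apply]
    exact fun h => lt_asymm h.2 Fin.castSucc_lt_succ
  have : inversions (simpleRefl i * p) =
      insert (p.symm i.castSucc, p.symm i.succ) (inversions p) := by
    ext ⟨a, b⟩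
    rw [mem_insert, mem_inversions, mem_inversions, Prod.mk.injEq, Equiv.Perm.mul_apply,
      Equiv.Perm.mul_apply]
    by_cases hab : a = b
    · subst hab
      have : ¬ (a = p.symm i.castSucc ∧ a = p.symm i.succ) := by
        rintro ⟨h1, h2⟩
        rw [← h1, ← h2] at h
        exact lt_irrefl _ h
      simp [this]
    · rw [simpleRefl_lt_iff i (fun e => hab (p.injective e)), Equiv.eq_symm_apply,
        Equiv.eq_symm_apply]
      constructor
      · rintro ⟨h1, h2 | h2⟩
        · exact Or.inl h2
        · exact Or.inr ⟨h1, h2.1⟩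
      · rintro (⟨h1, h2⟩ | ⟨h1, h2⟩)
        · refine ⟨?_, Or.inl ⟨h1, h2⟩⟩
          rwa [← h1, ← h2, Equiv.symm_apply_apply, Equiv.symm_apply_apply] at h
        · refine ⟨h1, Or.inr ⟨h2, ?_⟩⟩
          rintro ⟨h3, h4⟩
          rw [← h3, ← h4, Equiv.symm_apply_apply, Equiv.symm_apply_apply] at h
          exact lt_asymm h h1
  rw [inv, this, card_insert_of_notMem hmem, inv]

lemma inv_simpleRefl_mul_of_gt {m : ℕ} (i : Fin m) (p : Equiv.Perm (Fin (m + 1)))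
    (h : p.symm i.succ < p.symm i.castSucc) : inv (simpleRefl i * p) + 1 = inv p := by
  have h' : (simpleRefl i * p).symm i.castSucc < (simpleRefl i * p).symm i.succ := by
    have e : (simpleRefl i * p).symm = p⁻¹ * simpleRefl i := by
      change (simpleRefl i * p)⁻¹ = _
      rw [mul_inv_rev, inv_eq_of_mul_eq_one_left (simpleRefl_mul_self i)]
    rw [e]
    simpa [simpleRefl] using h
  rw [← inv_simpleRefl_mul_of_lt i _ h', ← mul_assoc, simpleRefl_mul_self, one_mul]

lemma inv_simpleRefl_mul_le {m : ℕ} (i : Fin m) (p : Equiv.Perm (Fin (m + 1))) :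
    inv (simpleRefl i * p) ≤ inv p + 1 := by
  rcases lt_trichotomy (p.symm i.castSucc) (p.symm i.succ) with h | h | h
  · exact (inv_simpleRefl_mul_of_lt i p h).le
  · exact absurd (p.symm.injective h) (Fin.castSucc_lt_succ (i := i)).ne
  · have := inv_simpleRefl_mul_of_gt i p h
    omega

@[simp] lemma wordProd_nil {m : ℕ} : wordProd ([] : Word m) = 1 := rfl

@[simp] lemma wordProd_cons {m : ℕ} (i : Fin m) (w : Word m) :
    wordProd (i :: w) = simpleRefl i * wordProd w := by simp [wordProd]

@[simp] lemma wordProd_append {m : ℕ} (u v : Word m) :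
    wordProd (u ++ v) = wordProd u * wordProd v := by simp [wordProd]

lemma inv_one {k : ℕ} : inv (1 : Equiv.Perm (Fin k)) = 0 := by
  simp only [inv, inversions, card_eq_zero, filter_eq_empty_iff]
  rintro ⟨a, b⟩ - ⟨h1, h2⟩
  exact lt_asymm h1 h2

lemma inv_wordProd_le {m : ℕ} (w : Word m) : inv (wordProd w) ≤ w.length := by
  induction w with
  | nil => simp [inv_one]
  | cons i w ih =>
    rw [wordProd_cons, List.length_cons]
    exact (inv_simpleRefl_mul_le i _).trans (by omega)

/-- Sort by removing descents of the inverse, each costing one inversion; without descents the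
inverse is increasing, hence the identity. -/
lemma exists_word_length_eq_inv {m : ℕ} (p : Equiv.Perm (Fin (m + 1))) :
    ∃ w : Word m, wordProd w = p ∧ w.length = inv p := by
  induction h : inv p using Nat.strong_induction_on generalizing p with
  | _ k ih =>
    by_cases hd : ∃ i : Fin m, p.symm i.succ < p.symm i.castSucc
    · obtain ⟨i, hi⟩ := hd
      have hlt := inv_simpleRefl_mul_of_gt i p hi
      obtain ⟨w, hw, hl⟩ := ih (inv (simpleRefl i * p)) (by omega) _ rfl
      refine ⟨i :: w, ?_, ?_⟩
      · rw [wordProd_cons, hw, ← mul_assoc, simpleRefl_mul_self, one_mul]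
      · rw [List.length_cons, hl]; omega
    · push Not at hd
      have hmono : StrictMono p.symm := Fin.strictMono_iff_lt_succ.2 fun i =>
        lt_of_le_of_ne (hd i) fun e =>
          (Fin.castSucc_lt_succ (i := i)).ne (p.symm.injective e)
      have hid : (p.symm : Fin (m + 1) → Fin (m + 1)) = id :=
        StrictMono.range_inj hmono strictMono_id |>.1
          (by rw [p.symm.surjective.range_eq, Set.range_id])
      have hp : p = 1 := by
        have : p.symm = 1 := Equiv.ext fun x => congrFun hid x
        exact inv_eq_one.1 this
      subst hp
      exact ⟨[], rfl, by rw [← h, inv_one]; rfl⟩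

/-- A word is reduced if and only if its length is the number of inversions. -/
lemma isReduced_iff {m : ℕ} (w : Word m) : IsReduced w ↔ w.length = inv (wordProd w) := by
  constructor
  · intro h
    obtain ⟨v, hv, hl⟩ := exists_word_length_eq_inv (wordProd w)
    exact le_antisymm (hl ▸ h v hv) (inv_wordProd_le w)
  · intro h v hv
    rw [h, ← hv]
    exact inv_wordProd_le v

lemma IsReduced.of_cons {m : ℕ} {i : Fin m} {w : Word m} (h : IsReduced (i :: w)) :
    IsReduced w := by
  rw [isReduced_iff] at h ⊢
  rw [wordProd_cons, List.length_cons] at h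
  have h1 := inv_simpleRefl_mul_le i (wordProd w)
  have h2 := inv_wordProd_le w
  omega

lemma isLongestWord_iff {m : ℕ} (w : Word m) : IsLongestWord w ↔
    wordProd w = Fin.revPerm ∧ w.length = inv (Fin.revPerm : Equiv.Perm (Fin (m + 1))) := by
  unfold IsLongestWord
  rw [isReduced_iff, and_comm]
  exact and_congr_right fun h => by rw [h]

lemma two_mul_inv_revPerm (m : ℕ) :
    2 * inv (Fin.revPerm : Equiv.Perm (Fin (m + 1))) = m * (m + 1) := by
  have h1 : inversions (Fin.revPerm : Equiv.Perm (Fin (m + 1))) =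
      univ.filter fun ab : Fin (m + 1) × Fin (m + 1) => ab.1 < ab.2 := by
    ext ⟨a, b⟩
    simp [inversions]
  have h2 : inv (Fin.revPerm : Equiv.Perm (Fin (m + 1))) = ∑ b : Fin (m + 1), (b : ℕ) := by
    rw [inv, h1, card_filter, ← univ_product_univ, sum_product_right]
    refine sum_congr rfl fun b _ => ?_
    rw [← card_filter]
    change (univ.filter (· < b)).card = b
    rw [Finset.filter_gt_eq_Iio, Fin.card_Iio]
  rw [h2, Fin.sum_univ_eq_sum_range (fun i => i), mul_comm, Finset.sum_range_id_mul_two]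
  simp [mul_comm]

/-- The product of a word without the letter `i` preserves the initial segment below `i`. -/
lemma wordProd_le_iff_of_notMem {m : ℕ} {i : Fin m} {w : Word m} (h : i ∉ w)
    (k : Fin (m + 1)) : wordProd w k ≤ i.castSucc ↔ k ≤ i.castSucc := by
  induction w with
  | nil => rfl
  | cons j w ih =>
    rw [List.mem_cons, not_or] at h
    rw [wordProd_cons, Equiv.Perm.mul_apply, ← ih h.2]
    have : (i : ℕ) ≠ j := fun e => h.1 (Fin.ext e)
    unfold simpleRefl
    simp only [Equiv.swap_apply_def, Fin.ext_iff, Fin.le_def, Fin.val_castSucc, Fin.val_succ]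
    split_ifs <;> simp_all <;> omega

lemma IsLongestWord.mem {m : ℕ} {w : Word m} (h : IsLongestWord w) (i : Fin m) : i ∈ w := by
  by_contra hi
  -- `w₀` sends the first point to the last, so it preserves no proper initial segment.
  have := (wordProd_le_iff_of_notMem hi 0).2 (Fin.zero_le _)
  rw [h.2] at this
  simp [Fin.le_def] at this
  omega

/-- A reduced word starting with `i` and another reduced word of the same element: the second
word contains `i`. -/
lemma IsReduced.mem_of_wordProd_eq {m : ℕ} {i : Fin m} {v w : Word m}
    (h : IsReduced (i :: v)) (he : wordProd w = wordProd (i :: v)) : i ∈ w := by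
  by_contra hi
  have h1 : (wordProd w).symm i.castSucc ≤ i.castSucc := by
    rw [← wordProd_le_iff_of_notMem hi, Equiv.apply_symm_apply]
  have h2 : ¬ (wordProd w).symm i.succ ≤ i.castSucc := by
    rw [← wordProd_le_iff_of_notMem hi, Equiv.apply_symm_apply]
    simp [Fin.le_def]
  -- A word without `i` keeps the preimages of `i` and `i + 1` in order, so multiplying by `s_i`
  -- lengthens the element; but it shortens the element of the reduced word `i :: v`.
  have h3 := inv_simpleRefl_mul_of_lt i (wordProd w) (h1.trans_lt (not_le.1 h2))
  have h4 := inv_wordProd_le v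
  rw [isReduced_iff, List.length_cons] at h
  rw [he, wordProd_cons, ← mul_assoc, simpleRefl_mul_self, one_mul, ← wordProd_cons] at h3
  omega

/-! ### Conjugation by `w₀` and rotation of reduced words -/

lemma simpleRefl_rev {m : ℕ} (i : Fin m) :
    simpleRefl i.rev = Fin.revPerm * simpleRefl i * Fin.revPerm := by
  have : (Fin.revPerm : Equiv.Perm (Fin (m + 1)))⁻¹ = Fin.revPerm := rfl
  conv_rhs => rw [← this]
  unfold simpleRefl
  rw [this]
  conv_rhs => rhs; rw [← this]
  rw [Equiv.mul_swap_eq_swap_mul, mul_assoc, mul_inv_cancel, mul_one, Equiv.swap_comm]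
  simp [Fin.rev_castSucc, Fin.rev_succ]

lemma revPerm_mul_revPerm {k : ℕ} :
    (Fin.revPerm : Equiv.Perm (Fin k)) * Fin.revPerm = 1 := by
  ext x; simp

/-- The length is unchanged, and `s_{i*} = w₀ s_i w₀` turns `s_i p = w₀` into `p s_{i*} = w₀`. -/
lemma isLongestWord_rotate {m : ℕ} (i : Fin m) (w : Word m) :
    IsLongestWord (i :: w) ↔ IsLongestWord (w ++ [i.rev]) := by
  rw [isLongestWord_iff, isLongestWord_iff]
  simp only [wordProd_cons, wordProd_append, wordProd_nil, mul_one, List.length_cons,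
    List.length_append, List.length_nil, zero_add, simpleRefl_rev]
  refine and_congr_left fun _ => ?_
  constructor
  · intro h
    have : wordProd w = simpleRefl i * Fin.revPerm := by
      rw [← h, ← mul_assoc, simpleRefl_mul_self, one_mul]
    rw [this]
    calc simpleRefl i * Fin.revPerm * (Fin.revPerm * simpleRefl i * Fin.revPerm)
        = simpleRefl i * (Fin.revPerm * Fin.revPerm) * simpleRefl i * Fin.revPerm := by
          simp only [mul_assoc]
      _ = _ := by rw [revPerm_mul_revPerm, mul_one, simpleRefl_mul_self, one_mul]
  · intro h
    have : wordProd w = Fin.revPerm * (Fin.revPerm * simpleRefl i * Fin.revPerm) := by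
      rw [← simpleRefl_rev] at h ⊢
      rw [← h, mul_assoc, simpleRefl_mul_self, mul_one]
    rw [this, ← mul_assoc, ← mul_assoc, ← mul_assoc, mul_assoc _ Fin.revPerm Fin.revPerm,
      revPerm_mul_revPerm, mul_one, simpleRefl_mul_self, one_mul]

/-! ### Commutation equivalence -/

lemma commClass_eq_iff {m : ℕ} {v w : Word m} :
    commClass v = commClass w ↔ Relation.EqvGen CommStep v w :=
  ⟨fun h => Quotient.exact h, fun h => Quotient.sound h⟩

/-- A property of words which is preserved by commutation relations is invariant under
commutation equivalence. -/
lemma iff_of_commClass_eq {m : ℕ} {p : Word m → Prop} (hp : ∀ v w, CommStep v w → p v → p w)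
    {v w : Word m} (h : commClass v = commClass w) : p v ↔ p w := by
  rw [commClass_eq_iff] at h
  induction h with
  | rel _ _ h =>
    refine ⟨hp _ _ h, hp _ _ ?_⟩
    obtain ⟨a, b, i, j, hne, hij⟩ := h
    exact .swap a b j i hne.symm fun k => hij k.symm
  | refl => rfl
  | symm _ _ _ ih => exact ih.symm
  | trans _ _ _ _ _ ih1 ih2 => exact ih1.trans ih2

lemma commClass_append {m : ℕ} {v w v' w' : Word m} (h : commClass v = commClass w)
    (h' : commClass v' = commClass w') : commClass (v ++ v') = commClass (w ++ w') := by
  have h1 : commClass (v ++ v') = commClass (w ++ v') := by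
    refine (iff_of_commClass_eq (p := fun u => commClass (v ++ v') = commClass (u ++ v'))
      ?_ h).1 rfl
    rintro _ _ ⟨a, b, i, j, hne, hij⟩ hv
    rw [hv, List.append_assoc, List.append_assoc]
    exact commClass_eq_iff.2 (.rel _ _ (.swap a (b ++ v') i j hne hij))
  refine (iff_of_commClass_eq (p := fun u => commClass (v ++ v') = commClass (w ++ u))
    ?_ h').1 h1
  rintro _ _ ⟨a, b, i, j, hne, hij⟩ hv
  rw [hv, ← List.append_assoc, ← List.append_assoc]
  exact commClass_eq_iff.2 (.rel _ _ (.swap (w ++ a) b i j hne hij))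

lemma commClass_cons {m : ℕ} (i : Fin m) {v w : Word m} (h : commClass v = commClass w) :
    commClass (i :: v) = commClass (i :: w) :=
  commClass_append (v := [i]) (w := [i]) rfl h

lemma perm_of_commClass_eq {m : ℕ} {v w : Word m} (h : commClass v = commClass w) :
    v.Perm w := by
  refine (iff_of_commClass_eq (p := fun w => v.Perm w) ?_ h).1 (List.Perm.refl v)
  rintro _ _ ⟨a, b, i, j, -, -⟩ hv
  exact hv.trans ((List.Perm.swap j i b).append_left a)

lemma simpleRefl_comm {m : ℕ} {i j : Fin m} (hne : i ≠ j) (hij : ¬ DynkinAdj i j) :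
    simpleRefl i * simpleRefl j = simpleRefl j * simpleRefl i := by
  have hne' : (i : ℕ) ≠ j := fun e => hne (Fin.ext e)
  unfold DynkinAdj at hij
  refine (Equiv.Perm.disjoint_swap_swap ?_).commute
  simp only [List.nodup_cons, List.mem_cons, List.not_mem_nil, Fin.ext_iff, Fin.val_castSucc,
    Fin.val_succ, List.nodup_nil, or_false, not_or, not_false_eq_true, and_true]
  omega

lemma wordProd_eq_of_commClass_eq {m : ℕ} {v w : Word m} (h : commClass v = commClass w) :
    wordProd v = wordProd w := by
  refine (iff_of_commClass_eq (p := fun w => wordProd v = wordProd w) ?_ h).1 rfl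
  rintro _ _ ⟨a, b, i, j, hne, hij⟩ hv
  rw [hv]
  simp only [wordProd_append, wordProd_cons]
  rw [← mul_assoc (simpleRefl i), simpleRefl_comm hne hij, mul_assoc (simpleRefl j)]

lemma isLongestWord_congr {m : ℕ} {v w : Word m} (h : commClass v = commClass w) :
    IsLongestWord v ↔ IsLongestWord w := by
  rw [isLongestWord_iff, isLongestWord_iff, wordProd_eq_of_commClass_eq h,
    (perm_of_commClass_eq h).length_eq]

/-- A letter can be moved to the front over letters which commute with it. -/
lemma commClass_cons_append {m : ℕ} (i : Fin m) (u v : Word m)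
    (hu : ∀ j ∈ u, j ≠ i ∧ ¬ DynkinAdj j i) :
    commClass (u ++ i :: v) = commClass (i :: (u ++ v)) := by
  induction u with
  | nil => rfl
  | cons j u ih =>
    have hj := hu j List.mem_cons_self
    rw [List.cons_append,
      commClass_cons j (ih fun k hk => hu k (List.mem_cons_of_mem _ hk))]
    exact commClass_eq_iff.2 (.rel _ _ (.swap [] _ j i hj.1 hj.2))

/-! ### Reflection functors -/

lemma self_mem_rCluster {m : ℕ} (c : CommClass m) : c ∈ rCluster c :=
  Relation.ReflTransGen.refl

/-! ### Firing systems -/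

/-- A system of states in which letters can be fired, in such a way that simultaneously enabled
letters are independent, together with an involution on states lifting the involution `*` on
letters. -/
structure FiringSystem (m : ℕ) (X : Type*) where
  /-- the letter is enabled at the state -/
  en : X → Fin m → Prop
  /-- the state after firing a letter -/
  fire : Fin m → X → X
  /-- the involution on states -/
  star : X → X
  not_adj : ∀ {x i j}, en x i → en x j → i ≠ j → ¬ DynkinAdj i j
  en_fire : ∀ {x i j}, en x i → en x j → i ≠ j → en (fire i x) j
  fire_comm : ∀ {x i j}, en x i → en x j → fire j (fire i x) = fire i (fire j x)
  en_of_fire : ∀ {x i j}, en x i → en (fire i x) j → i ≠ j → ¬ DynkinAdj i j → en x j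
  star_star : ∀ x, star (star x) = x
  en_star : ∀ {x i}, en x i → en (star x) i.rev
  fire_star : ∀ {x i}, en x i → fire i.rev (star x) = star (fire i x)

namespace FiringSystem

variable {m : ℕ} {X : Type*} (F : FiringSystem m X)

/-- The letters of the word can be fired one after the other. -/
def Adapted : X → Word m → Prop
  | _, [] => True
  | x, i :: w => F.en x i ∧ Adapted (F.fire i x) w

/-- The state after firing the letters of a word. -/
def run : X → Word m → X
  | x, [] => x
  | x, i :: w => run (F.fire i x) w

lemma run_append (x : X) (u v : Word m) : F.run x (u ++ v) = F.run (F.run x u) v := by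
  induction u generalizing x with
  | nil => rfl
  | cons i u ih => exact ih _

lemma adapted_append (x : X) (u v : Word m) :
    F.Adapted x (u ++ v) ↔ F.Adapted x u ∧ F.Adapted (F.run x u) v := by
  induction u generalizing x with
  | nil => simp [Adapted, run]
  | cons i u ih => simp [Adapted, run, ih, and_assoc]

lemma adapted_run_of_commStep {x y : X} {v w : Word m} (h : CommStep v w) :
    F.Adapted x v ∧ F.run x v = y → F.Adapted x w ∧ F.run x w = y := by
  obtain ⟨a, b, i, j, hne, hij⟩ := h
  simp only [adapted_append, run_append, Adapted, run]
  rintro ⟨⟨h1, h2, h3, h4⟩, h5⟩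
  have hj := F.en_of_fire h2 h3 hne hij
  have hc := F.fire_comm h2 hj
  rw [hc] at h4 h5
  exact ⟨⟨h1, hj, F.en_fire hj h2 hne.symm, h4⟩, h5⟩

lemma adapted_run_congr {x y : X} {v w : Word m} (h : commClass v = commClass w) :
    F.Adapted x v ∧ F.run x v = y ↔ F.Adapted x w ∧ F.run x w = y :=
  iff_of_commClass_eq (p := fun w => F.Adapted x w ∧ F.run x w = y)
    (fun _ _ h => F.adapted_run_of_commStep h) h

lemma adapted_congr {x : X} {v w : Word m} (h : commClass v = commClass w) :
    F.Adapted x v ↔ F.Adapted x w :=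
  ⟨fun hv => ((F.adapted_run_congr h).1 ⟨hv, rfl⟩).1,
    fun hw => ((F.adapted_run_congr h).2 ⟨hw, rfl⟩).1⟩

/-- An enabled letter which occurs in an adapted word can be moved to the front. -/
lemma exists_cons_of_mem {x : X} {i : Fin m} {w : Word m} (hw : F.Adapted x w) (hi : F.en x i)
    (hmem : i ∈ w) : ∃ v, commClass w = commClass (i :: v) := by
  suffices h : ∃ u v, w = u ++ i :: v ∧ ∀ j ∈ u, j ≠ i ∧ ¬ DynkinAdj j i by
    obtain ⟨u, v, rfl, hu⟩ := h
    exact ⟨u ++ v, commClass_cons_append i u v hu⟩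
  induction w generalizing x with
  | nil => simp at hmem
  | cons j w ih =>
    by_cases hj : j = i
    · exact ⟨[], w, by rw [hj]; rfl, by simp⟩
    -- Firing `j` leaves `i` enabled, so each letter before the first `i` is enabled together with
    -- `i` and commutes with it.
    · obtain ⟨u, v, huv, hu⟩ := ih hw.2 (F.en_fire hw.1 hi hj)
        ((List.mem_cons.1 hmem).resolve_left (Ne.symm hj))
      refine ⟨j :: u, v, by rw [huv]; rfl, fun k hk => ?_⟩
      rcases List.mem_cons.1 hk with rfl | hk
      · exact ⟨hj, F.not_adj hw.1 hi hj⟩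
      · exact hu k hk

/-- Adapted words with the same letters are commutation equivalent. -/
lemma commClass_eq_of_perm {x : X} {v w : Word m} (hv : F.Adapted x v) (hw : F.Adapted x w)
    (h : v.Perm w) : commClass v = commClass w := by
  induction v generalizing x w with
  | nil => rw [List.nil_perm.1 h]
  | cons i v ih =>
    obtain ⟨w', hw'⟩ := F.exists_cons_of_mem hw hv.1 (h.subset List.mem_cons_self)
    rw [hw']
    refine commClass_cons i (ih hv.2 ((F.adapted_congr hw').1 hw).2 ?_)
    exact (List.perm_cons i).1 (h.trans (perm_of_commClass_eq hw'))

/-- Adapted reduced words of the same element are commutation equivalent. -/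
lemma commClass_eq_of_wordProd_eq {x : X} {v w : Word m} (hv : F.Adapted x v)
    (hw : F.Adapted x w) (hvr : IsReduced v) (hwr : IsReduced w)
    (h : wordProd v = wordProd w) : commClass v = commClass w := by
  induction v generalizing x w with
  | nil =>
    rw [isReduced_iff, ← h, wordProd_nil, inv_one, List.length_eq_zero_iff] at hwr
    rw [hwr]
  | cons i v ih =>
    obtain ⟨w', hw'⟩ := F.exists_cons_of_mem hw hv.1 (hvr.mem_of_wordProd_eq h.symm)
    have hp := wordProd_eq_of_commClass_eq hw'
    rw [hw']
    refine commClass_cons i (ih hv.2 ((F.adapted_congr hw').1 hw).2 hvr.of_cons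
      (IsReduced.of_cons (i := i) ?_) ?_)
    · rw [isReduced_iff] at hwr ⊢
      rw [← hp, ← hwr, (perm_of_commClass_eq hw').length_eq]
    · rw [← h, wordProd_cons, wordProd_cons] at hp
      exact mul_left_cancel hp

/-- `w` is a reduced word of `w₀` which leads from the state `x` to its dual state. -/
structure Good (x : X) (w : Word m) : Prop where
  adapted : F.Adapted x w
  run_eq : F.run x w = F.star x
  isLongestWord : IsLongestWord w

variable {F}

lemma Good.congr {x : X} {v w : Word m} (hv : F.Good x v) (h : commClass v = commClass w) :
    F.Good x w :=
  have := (F.adapted_run_congr h).1 ⟨hv.adapted, hv.run_eq⟩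
  ⟨this.1, this.2, (isLongestWord_congr h).1 hv.isLongestWord⟩

lemma Good.commClass_eq {x : X} {v w : Word m} (hv : F.Good x v) (hw : F.Adapted x w)
    (hl : IsLongestWord w) : commClass v = commClass w :=
  F.commClass_eq_of_wordProd_eq hv.adapted hw hv.isLongestWord.1 hl.1
    (hv.isLongestWord.2.trans hl.2.symm)

lemma Good.of_adapted {x : X} {v w : Word m} (hv : F.Good x v) (hw : F.Adapted x w)
    (hl : IsLongestWord w) : F.Good x w :=
  hv.congr (hv.commClass_eq hw hl)

/-- After `w` the state is the dual of `x`, where `i*` is enabled; firing it there gives the dual of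
the fired state. -/
lemma Good.rotate {x : X} {i : Fin m} {w : Word m} (h : F.Good x (i :: w)) :
    F.Good (F.fire i x) (w ++ [i.rev]) := by
  obtain ⟨⟨h1, h2⟩, h3, h4⟩ := h
  have h3' : F.run (F.fire i x) w = F.star x := h3
  refine ⟨?_, ?_, (isLongestWord_rotate i w).1 h4⟩
  · rw [adapted_append, h3']
    exact ⟨h2, F.en_star h1, trivial⟩
  · rw [run_append, h3']
    exact F.fire_star h1

/-- The preceding state is the dual of the state reached just before the last letter. -/
lemma Good.rotate_symm {x : X} {i : Fin m} {w : Word m} (h : F.Good x (w ++ [i])) :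
    ∃ y, F.Good y (i.rev :: w) ∧ F.fire i.rev y = x := by
  obtain ⟨h1, h3, h4⟩ := h
  rw [adapted_append] at h1
  rw [run_append] at h3
  have h3' : F.fire i (F.run x w) = F.star x := h3
  have hf : F.fire i.rev (F.star (F.run x w)) = x := by
    rw [F.fire_star h1.2.1, h3', F.star_star]
  refine ⟨F.star (F.run x w), ⟨⟨F.en_star h1.2.1, ?_⟩, ?_, ?_⟩, hf⟩
  · rw [hf]; exact h1.1
  · change F.run (F.fire _ _) w = _
    rw [hf, F.star_star]
  · rw [isLongestWord_rotate, Fin.rev_rev]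
    exact h4

lemma Good.exists_cons {x : X} {i : Fin m} {w : Word m} (h : F.Good x w) (hi : F.en x i) :
    ∃ v, commClass w = commClass (i :: v) ∧ F.Good x (i :: v) := by
  obtain ⟨v, hv⟩ := F.exists_cons_of_mem h.adapted hi (h.isLongestWord.mem i)
  exact ⟨v, hv, h.congr hv⟩

variable (F)

/-- Two states are neighbours if one is obtained from the other by firing an enabled letter. -/
def Step (x y : X) : Prop := ∃ i, F.en x i ∧ y = F.fire i x

variable {F}

/-- An enabled letter occurs in every reduced word of `w₀`, so it can be brought to the front and
rotated: a firing of states is realized by a reflection functor. -/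
lemma Good.exists_good_of_step {x y : X} {c : CommClass m} (h : F.Step x y)
    (hx : ∃ w, F.Good x w ∧ commClass w ∈ rCluster c) :
    ∃ w, F.Good y w ∧ commClass w ∈ rCluster c := by
  obtain ⟨i, hi, rfl⟩ := h
  obtain ⟨w, hw, hc⟩ := hx
  obtain ⟨v, hv, hg⟩ := hw.exists_cons hi
  exact ⟨_, hg.rotate, Relation.ReflTransGen.tail hc ⟨i, v, Or.inl ⟨hv, rfl⟩⟩⟩

lemma Good.exists_good {x y : X} {v : Word m} (hv : F.Good x v)
    (h : Relation.ReflTransGen F.Step x y) :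
    ∃ w, F.Good y w ∧ commClass w ∈ rCluster (commClass v) := by
  induction h with
  | refl => exact ⟨v, hv, self_mem_rCluster _⟩
  | tail _ h ih => exact Good.exists_good_of_step h ih

/-- Conversely, every reflection functor rotates a good word, so the cluster never leaves the
classes of states. -/
lemma Good.of_mem_rCluster {x : X} {v : Word m} (hv : F.Good x v) {c : CommClass m}
    (hc : c ∈ rCluster (commClass v)) : ∃ y w, F.Good y w ∧ commClass w = c := by
  induction hc with
  | refl => exact ⟨x, v, hv, rfl⟩
  | tail _ h ih =>
    obtain ⟨y, w, hw, rfl⟩ := ih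
    obtain ⟨i, u, ⟨h1, rfl⟩ | ⟨h1, rfl⟩⟩ := h
    · exact ⟨_, _, (hw.congr h1).rotate, rfl⟩
    · obtain ⟨z, hz, -⟩ := (hw.congr h1).rotate_symm
      exact ⟨z, _, hz, rfl⟩

lemma reflTransGen_step_run {x : X} {w : Word m} (h : F.Adapted x w) :
    Relation.ReflTransGen F.Step x (F.run x w) := by
  induction w generalizing x with
  | nil => exact .refl
  | cons i w ih => exact .head ⟨i, h.1, rfl⟩ (ih h.2)

lemma Good.isSink_iff {x : X} {w : Word m} (hw : F.Good x w) (i : Fin m) :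
    IsSink i (commClass w) ↔ F.en x i := by
  constructor
  · rintro ⟨v, hv⟩
    exact (hw.congr hv).adapted.1
  · intro hi
    obtain ⟨v, hv, -⟩ := hw.exists_cons hi
    exact ⟨v, hv⟩

lemma Good.isSource_of_en {x : X} {w : Word m} {i : Fin m} (hi : F.en x i.rev)
    (hx : ∃ v, F.Good x v) (hw : F.Good (F.fire i.rev x) w) : IsSource i (commClass w) := by
  obtain ⟨v, hv⟩ := hx
  obtain ⟨u, -, hu⟩ := hv.exists_cons hi
  have := hu.rotate
  rw [Fin.rev_rev] at this
  exact ⟨u, hw.commClass_eq this.adapted this.isLongestWord⟩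

lemma Good.exists_of_isSource {x : X} {w : Word m} {i : Fin m} (hw : F.Good x w)
    (h : IsSource i (commClass w)) : ∃ y, F.en y i.rev ∧ F.fire i.rev y = x := by
  obtain ⟨v, hv⟩ := h
  obtain ⟨y, hy, he⟩ := (hw.congr hv).rotate_symm
  exact ⟨y, hy.adapted.1, he⟩

end FiringSystem

/-! ### Dynkin quivers -/

lemma DynkinAdj.symm {m : ℕ} {i j : Fin m} (h : DynkinAdj i j) : DynkinAdj j i := Or.symm h

lemma dynkinAdj_rev {m : ℕ} {i j : Fin m} : DynkinAdj i.rev j.rev ↔ DynkinAdj i j := by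
  simp only [DynkinAdj, Fin.val_rev]
  omega

lemma not_dynkinAdj_self {m : ℕ} (i : Fin m) : ¬ DynkinAdj i i := by
  simp [DynkinAdj]

namespace DynkinQuiver

variable {m : ℕ}

lemma not_arrow_symm {Q : DynkinQuiver m} {i j : Fin m} (h : Q.arrow i j) : ¬ Q.arrow j i :=
  fun h' => (Q.oriented i j (Q.adj_of_arrow i j h)).elim (fun k => k.2 h') fun k => k.2 h

lemma arrow_or {Q : DynkinQuiver m} {i j : Fin m} (h : DynkinAdj i j) :
    Q.arrow i j ∨ Q.arrow j i :=
  (Q.oriented i j h).imp And.left And.left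

lemma reflect_arrow (Q : DynkinQuiver m) (i a b : Fin m) : (reflect i Q).arrow a b ↔
    (a = i ∨ b = i) ∧ Q.arrow b a ∨ ¬ (a = i ∨ b = i) ∧ Q.arrow a b := Iff.rfl

lemma reflect_comm (Q : DynkinQuiver m) (i j : Fin m) :
    reflect j (reflect i Q) = reflect i (reflect j Q) := by
  ext a b
  simp only [reflect_arrow]
  tauto

/-- The quiver transported along the diagram automorphism `*`. -/
def star (Q : DynkinQuiver m) : DynkinQuiver m where
  arrow a b := Q.arrow a.rev b.rev
  adj_of_arrow _ _ h := dynkinAdj_rev.1 (Q.adj_of_arrow _ _ h)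
  oriented _ _ h := Q.oriented _ _ (dynkinAdj_rev.2 h)

lemma star_arrow (Q : DynkinQuiver m) (a b : Fin m) :
    Q.star.arrow a b ↔ Q.arrow a.rev b.rev := Iff.rfl

/-- The opposite quiver. -/
def op (Q : DynkinQuiver m) : DynkinQuiver m where
  arrow a b := Q.arrow b a
  adj_of_arrow _ _ h := (Q.adj_of_arrow _ _ h).symm
  oriented _ _ h := Q.oriented _ _ h.symm

lemma reflect_star (Q : DynkinQuiver m) (i : Fin m) :
    reflect i.rev Q.star = (reflect i Q).star := by
  ext a b
  simp only [reflect_arrow, star_arrow, Fin.rev_eq_iff]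

/-- Dynkin quivers with the reflections at sinks as a firing system. -/
def firing (m : ℕ) : FiringSystem m (DynkinQuiver m) where
  en := IsSink
  fire := reflect
  star := star
  not_adj := fun {Q i j} hi hj _ h => (Q.arrow_or h).elim (hi j) (hj i)
  en_fire := fun {Q i j} hi hj hij k h => by
    rcases h with ⟨h1 | rfl, h2⟩ | h
    · exact hij h1.symm
    · exact hi j h2
    · exact hj k h.2
  fire_comm := fun {Q i j} _ _ => reflect_comm Q i j
  en_of_fire := fun {Q i j} hi hj hij hadj k h => by
    refine hj k (Or.inr ⟨?_, h⟩)
    rintro (rfl | rfl)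
    · exact hij rfl
    · exact hadj (Q.adj_of_arrow _ _ h).symm
  star_star := fun Q => by
    ext a b
    simp only [star_arrow, Fin.rev_rev]
  en_star := fun {Q i} hi j h => by
    rw [star_arrow, Fin.rev_rev] at h
    exact hi _ h
  fire_star := fun {Q i} _ => Q.reflect_star i

lemma adapted_iff (Q : DynkinQuiver m) (w : Word m) :
    Q.Adapted w ↔ (firing m).Adapted Q w := by
  induction w generalizing Q with
  | nil => exact Iff.rfl
  | cons i w ih => exact and_congr_right fun _ => ih _

/-- The orientation of an edge is read off from which of its two ends occurs first in the word: that
end is a sink, and earlier firings do not touch the edge. -/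
lemma arrow_iff_of_adapted {Q R : DynkinQuiver m} {w : Word m} (hQ : Q.Adapted w)
    (hR : R.Adapted w) {i j : Fin m} (hi : i ∈ w) : Q.arrow i j ↔ R.arrow i j := by
  by_cases hij : DynkinAdj i j
  swap
  · exact iff_of_false (fun h => hij (Q.adj_of_arrow _ _ h)) fun h => hij (R.adj_of_arrow _ _ h)
  induction w generalizing Q R with
  | nil => simp at hi
  | cons k w ih =>
    by_cases hki : i = k
    · subst hki
      exact iff_of_false (hQ.1 j) (hR.1 j)
    by_cases hkj : j = k
    · subst hkj
      exact iff_of_true ((Q.arrow_or hij).resolve_right (hQ.1 i))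
        ((R.arrow_or hij).resolve_right (hR.1 i))
    have := ih hQ.2 hR.2 ((List.mem_cons.1 hi).resolve_left hki)
    simpa only [reflect_arrow, hki, hkj, or_self, false_and, not_false_eq_true, true_and,
      false_or] using this

/-- A quiver is determined by a reduced word of `w₀` adapted to it. -/
lemma eq_of_adapted {Q R : DynkinQuiver m} {w : Word m} (hw : IsLongestWord w)
    (hQ : Q.Adapted w) (hR : R.Adapted w) : Q = R := by
  ext i j
  exact arrow_iff_of_adapted hQ hR (hw.mem i)

/-! ### Counting and connecting Dynkin quivers -/

/-- The quiver with prescribed set of arrows `i → i + 1`. -/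
def ofUp (S : Set (Fin m)) : DynkinQuiver m where
  arrow a b := (a : ℕ) + 1 = b ∧ a ∈ S ∨ (b : ℕ) + 1 = a ∧ b ∉ S
  adj_of_arrow a b h := h.imp And.left And.left
  oriented a b h := by
    unfold DynkinAdj at h
    unfold Xor
    by_cases h1 : (a : ℕ) + 1 = b
    · have h2 : ¬ (b : ℕ) + 1 = a := by omega
      simp only [h1, h2, true_and, false_and, or_false, false_or]
      tauto
    · have h2 : (b : ℕ) + 1 = a := by omega
      simp only [h1, h2, true_and, false_and, or_false, false_or]
      tauto

/-- The vertices `i` with an arrow `i → i + 1`. -/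
def up (Q : DynkinQuiver m) : Set (Fin m) :=
  {i | ∃ j : Fin m, (i : ℕ) + 1 = j ∧ Q.arrow i j}

lemma mem_up_iff {Q : DynkinQuiver m} {i j : Fin m} (h : (i : ℕ) + 1 = j) :
    i ∈ Q.up ↔ Q.arrow i j := by
  constructor
  · rintro ⟨k, hk, h'⟩
    have : k = j := Fin.ext (by omega)
    rwa [← this]
  · exact fun h' => ⟨j, h, h'⟩

lemma ofUp_up (Q : DynkinQuiver m) : ofUp Q.up = Q := by
  ext a b
  change ((a : ℕ) + 1 = b ∧ a ∈ Q.up ∨ (b : ℕ) + 1 = a ∧ b ∉ Q.up) ↔ _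
  constructor
  · rintro (⟨h1, h2⟩ | ⟨h1, h2⟩)
    · exact (mem_up_iff h1).1 h2
    · rw [mem_up_iff h1] at h2
      exact (Q.arrow_or (Or.inr h1)).resolve_right h2
  · intro h
    rcases Q.adj_of_arrow a b h with h1 | h1
    · exact Or.inl ⟨h1, (mem_up_iff h1).2 h⟩
    · exact Or.inr ⟨h1, fun h2 => not_arrow_symm h ((mem_up_iff h1).1 h2)⟩

lemma up_ofUp (S : Set (Fin m)) : (ofUp S).up = {i ∈ S | (i : ℕ) + 1 < m} := by
  ext i
  constructor
  · rintro ⟨j, hj, ⟨-, h⟩ | ⟨h, -⟩⟩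
    · exact ⟨h, by omega⟩
    · omega
  · rintro ⟨hi, h⟩
    exact ⟨⟨i + 1, h⟩, rfl, Or.inl ⟨rfl, hi⟩⟩

lemma card_eq (m : ℕ) : Nat.card (DynkinQuiver (m + 1)) = 2 ^ m := by
  have e : DynkinQuiver (m + 1) ≃ Set (Fin m) :=
    { toFun := fun Q => Fin.castSucc ⁻¹' Q.up
      invFun := fun S => ofUp (Fin.castSucc '' S)
      left_inv := fun Q => by
        -- The top vertex never lies in `up`, so the vertices in the image of `Fin.castSucc` index
        -- all edges.
        conv_rhs => rw [← ofUp_up Q]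
        refine congrArg ofUp (Set.ext fun i => ?_)
        constructor
        · rintro ⟨k, hk, rfl⟩
          exact hk
        · intro h
          obtain ⟨j, hj, -⟩ := id h
          exact ⟨⟨i, by omega⟩, h, rfl⟩
      right_inv := fun S => by
        ext i
        simp [up_ofUp] }
  rw [Nat.card_congr e, Nat.card_eq_fintype_card, Fintype.card_set, Fintype.card_fin]

/-- The head of the topmost upward arrow is a sink. Firing it can only push upward arrows towards
the end of the diagram, where they vanish; the weight `m - i` measures the remaining distance. -/
lemma reflTransGen_step_ofUp_empty (Q : DynkinQuiver m) :
    Relation.ReflTransGen (firing m).Step Q (ofUp ∅) := by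
  classical
  induction h : ∑ i with i ∈ Q.up, (m - (i : ℕ)) using Nat.strong_induction_on
    generalizing Q with
  | _ k ih =>
    by_cases he : Q.up = ∅
    · rw [← he, ofUp_up]
    · obtain ⟨i, hi, hmax⟩ := Set.exists_max_image Q.up id (Set.toFinite _)
        (Set.nonempty_iff_ne_empty.2 he)
      obtain ⟨j, hj, hij⟩ := id hi
      have hsink : Q.IsSink j := fun l hl => by
        rcases Q.adj_of_arrow _ _ hl with h1 | h1
        · have := hmax j ⟨l, h1, hl⟩
          simp only [id, Fin.le_def] at this
          omega
        · have : l = i := Fin.ext (by omega)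
          subst this
          exact not_arrow_symm hij hl
      refine .head ⟨j, hsink, rfl⟩ (ih _ ?_ _ rfl)
      -- The vertex `i` leaves `up`, and at most `j = i + 1`, of smaller weight, joins it.
      have hsub : (Finset.univ.filter fun a => a ∈ (reflect j Q).up) ⊆
          insert j ((Finset.univ.filter fun a => a ∈ Q.up).erase i) := by
        intro a ha
        simp only [Finset.mem_filter, Finset.mem_univ, true_and, Finset.mem_insert,
          Finset.mem_erase] at ha ⊢
        obtain ⟨b, hb, hab⟩ := ha
        by_cases haj : a = j
        · exact Or.inl haj
        · rcases hab with ⟨h1, h2⟩ | ⟨h1, h2⟩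
          · rcases h1 with h1 | rfl
            · exact absurd h1 haj
            · exact absurd h2 (hsink a)
          · refine Or.inr ⟨?_, b, hb, h2⟩
            rintro rfl
            exact h1 (Or.inr (Fin.ext (by omega)))
      have hi' : i ∈ Finset.univ.filter fun a => a ∈ Q.up := by simpa using hi
      calc _ ≤ _ := Finset.sum_le_sum_of_subset hsub
        _ ≤ (m - (j : ℕ)) +
            ∑ a ∈ (Finset.univ.filter fun a => a ∈ Q.up).erase i, (m - (a : ℕ)) := by
          by_cases hmem : j ∈ (Finset.univ.filter fun a => a ∈ Q.up).erase i
          · rw [Finset.insert_eq_of_mem hmem]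
            exact Nat.le_add_left _ _
          · rw [Finset.sum_insert hmem]
        _ < (m - (i : ℕ)) +
            ∑ a ∈ (Finset.univ.filter fun a => a ∈ Q.up).erase i, (m - (a : ℕ)) := by
          have := i.isLt
          omega
        _ = k := by rw [Finset.add_sum_erase _ (fun a : Fin m => m - (a : ℕ)) hi', h]

/-- A fired sink has become a source, hence a sink of the opposite quiver; this lets paths of
firings be run backwards. -/
lemma step_op {Q R : DynkinQuiver m} (h : (firing m).Step Q R) :
    (firing m).Step R.op Q.op := by
  obtain ⟨i, hi, rfl⟩ := h
  have hop (a b : Fin m) (P : DynkinQuiver m) : P.op.arrow a b ↔ P.arrow b a := Iff.rfl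
  refine ⟨i, fun j hj => ?_, ?_⟩
  · rcases hj with ⟨-, h⟩ | ⟨h, -⟩
    · exact hi j h
    · exact h (Or.inr rfl)
  · change Q.op = reflect i ((reflect i Q).op)
    ext a b
    simp only [reflect_arrow, hop]
    tauto

lemma reflTransGen_step_op {Q R : DynkinQuiver m}
    (h : Relation.ReflTransGen (firing m).Step Q R) :
    Relation.ReflTransGen (firing m).Step R.op Q.op := by
  induction h with
  | refl => exact .refl
  | tail _ h ih => exact .head (step_op h) ih

lemma star_ofUp_empty : (ofUp ∅ : DynkinQuiver m).star = (ofUp ∅).op := by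
  ext a b
  change ((_ ∧ _ ∈ (∅ : Set (Fin m))) ∨ _ ∧ _ ∉ (∅ : Set (Fin m))) ↔
    ((_ ∧ _ ∈ (∅ : Set (Fin m))) ∨ _ ∧ _ ∉ (∅ : Set (Fin m)))
  simp only [Set.mem_empty_iff_false, and_false, false_or, not_false_eq_true, and_true,
    Fin.val_rev]
  omega

/-- If some quiver has an adapted reduced word of `w₀`, then any two quivers are related by
reflections at sinks. -/
lemma reflTransGen_step {Q₀ : DynkinQuiver m} {w : Word m} (hw : (firing m).Good Q₀ w)
    (Q R : DynkinQuiver m) : Relation.ReflTransGen (firing m).Step Q R := by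
  -- A good word at `ofUp ∅` is a path to its dual, which is also its opposite. This bridges the
  -- path from `Q` down to `ofUp ∅` and the reversed path that ends at `R`.
  obtain ⟨v, hv, -⟩ := hw.exists_good (reflTransGen_step_ofUp_empty Q₀)
  have h := FiringSystem.reflTransGen_step_run hv.adapted
  rw [hv.run_eq] at h
  change Relation.ReflTransGen _ _ (ofUp ∅).star at h
  rw [star_ofUp_empty] at h
  exact (reflTransGen_step_ofUp_empty Q).trans
    (h.trans (reflTransGen_step_op (reflTransGen_step_ofUp_empty R.op)))

end DynkinQuiver

/-! ### The map `P` on letters and words -/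

lemma letterP_mid (n : ℕ) : letterP n (mid n) = none := by
  simp [letterP, mid]

lemma letterP_eq_none_iff {n : ℕ} {i : Fin (2 * n + 1)} : letterP n i = none ↔ i = mid n := by
  unfold letterP mid
  rw [Fin.ext_iff]
  split_ifs <;> simp <;> omega

lemma letterP_eq_some_iff {n : ℕ} {i : Fin (2 * n + 1)} {k : Fin (2 * n)} :
    letterP n i = some k ↔ (i : ℕ) < n ∧ (k : ℕ) = i ∨ n < (i : ℕ) ∧ (k : ℕ) + 1 = i := by
  unfold letterP
  split_ifs <;> simp [Fin.ext_iff] <;> omega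

lemma dynkinAdj_mid {n : ℕ} {i : Fin (2 * n + 1)} :
    DynkinAdj i (mid n) ↔ (i : ℕ) + 1 = n ∨ (i : ℕ) = n + 1 := by
  simp [DynkinAdj, mid, eq_comm]

lemma mid_rev (n : ℕ) : (mid n).rev = mid n := by
  simp only [Fin.ext_iff, Fin.val_rev, mid]
  omega

lemma letterP_rev {n : ℕ} (i : Fin (2 * n + 1)) : letterP n i.rev = (letterP n i).map Fin.rev := by
  cases h : letterP n i with
  | none => rw [letterP_eq_none_iff.1 h, mid_rev, letterP_mid]; rfl
  | some k =>
    rw [Option.map_some, letterP_eq_some_iff]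
    rw [letterP_eq_some_iff] at h
    simp only [Fin.val_rev]
    omega

/-- The letter of `I_{2n+1}` different from `n + 1` with given image under `P`. -/
def liftLetter (n : ℕ) (k : Fin (2 * n)) : Fin (2 * n + 1) :=
  if (k : ℕ) < n then k.castSucc else k.succ

lemma letterP_eq_some_iff_liftLetter {n : ℕ} {i : Fin (2 * n + 1)} {k : Fin (2 * n)} :
    letterP n i = some k ↔ i = liftLetter n k := by
  rw [letterP_eq_some_iff, liftLetter, Fin.ext_iff]
  split_ifs <;> simp <;> omega

@[simp] lemma wordP_nil (n : ℕ) : wordP n [] = [] := rfl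

lemma wordP_append {n : ℕ} (u v : Word (2 * n + 1)) :
    wordP n (u ++ v) = wordP n u ++ wordP n v := List.filterMap_append

@[simp] lemma wordP_mid_cons {n : ℕ} (w : Word (2 * n + 1)) : wordP n (mid n :: w) = wordP n w :=
  List.filterMap_cons_none (letterP_mid n)

lemma wordP_cons_of_eq_some {n : ℕ} {i : Fin (2 * n + 1)} {k : Fin (2 * n)}
    (h : letterP n i = some k) (w : Word (2 * n + 1)) : wordP n (i :: w) = k :: wordP n w :=
  List.filterMap_cons_some h

@[simp] lemma wordP_liftLetter_cons {n : ℕ} (k : Fin (2 * n)) (w : Word (2 * n + 1)) :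
    wordP n (liftLetter n k :: w) = k :: wordP n w :=
  wordP_cons_of_eq_some (letterP_eq_some_iff_liftLetter.2 rfl) w

lemma wordP_perm {n : ℕ} {v w : Word (2 * n + 1)} (h : v.Perm w) :
    (wordP n v).Perm (wordP n w) := h.filterMap _

lemma wordP_map_rev {n : ℕ} (w : Word (2 * n + 1)) :
    wordP n (w.map Fin.rev) = (wordP n w).map Fin.rev := by
  unfold wordP
  rw [List.filterMap_map, List.map_filterMap]
  exact congrArg (fun f => List.filterMap f w) (funext letterP_rev)

lemma liftLetter_ne_mid {n : ℕ} (k : Fin (2 * n)) : liftLetter n k ≠ mid n := fun h => by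
  have := letterP_eq_some_iff_liftLetter.2 h.symm
  rw [letterP_mid] at this
  cases this

/-- Case distinction on the letters of `I_{2n+1}`. -/
lemma eq_mid_or_eq_liftLetter {n : ℕ} (i : Fin (2 * n + 1)) :
    i = mid n ∨ ∃ k, i = liftLetter n k := by
  cases h : letterP n i with
  | none => exact Or.inl (letterP_eq_none_iff.1 h)
  | some k => exact Or.inr ⟨k, letterP_eq_some_iff_liftLetter.1 h⟩

lemma perm_wordP_append {n : ℕ} (w : Word (2 * n + 1)) :
    w.Perm ((wordP n w).map (liftLetter n) ++ List.replicate (w.count (mid n)) (mid n)) := by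
  induction w with
  | nil => simp
  | cons i w ih =>
    rcases eq_mid_or_eq_liftLetter i with rfl | ⟨k, rfl⟩
    · rw [wordP_mid_cons, List.count_cons_self, List.replicate_succ]
      exact (ih.cons _).trans List.perm_middle.symm
    · rw [wordP_liftLetter_cons, List.count_cons_of_ne (liftLetter_ne_mid k)]
      exact ih.cons _

/-! ### Twisted quivers -/

/-- Dynkin quivers of type `A_{2n}` together with a flag which tells whether the letter `n + 1`
or one of its neighbours comes next, as a firing system of type `A_{2n+1}`. -/
def twistedFiring (n : ℕ) : FiringSystem (2 * n + 1) (DynkinQuiver (2 * n) × Bool) where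
  en s i := (∀ k, letterP n i = some k → s.1.IsSink k) ∧ (i = mid n → s.2 = true) ∧
    (DynkinAdj i (mid n) → s.2 = false)
  fire i s := ((letterP n i).elim s.1 fun k => DynkinQuiver.reflect k s.1,
    if i = mid n then false else if DynkinAdj i (mid n) then true else s.2)
  star s := (s.1.star, s.2)
  not_adj := fun {s i j} hi hj hij h => by
    rcases eq_mid_or_eq_liftLetter i with rfl | ⟨k, rfl⟩
    · simpa [hi.2.1 rfl] using hj.2.2 h.symm
    rcases eq_mid_or_eq_liftLetter j with rfl | ⟨l, rfl⟩
    · simpa [hj.2.1 rfl] using hi.2.2 h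
    have hk := letterP_eq_some_iff_liftLetter.2 (rfl : liftLetter n k = _)
    have hl := letterP_eq_some_iff_liftLetter.2 (rfl : liftLetter n l = _)
    refine (DynkinQuiver.firing _).not_adj (hi.1 k hk) (hj.1 l hl) ?_ ?_
    · rintro rfl; exact hij rfl
    · rw [letterP_eq_some_iff] at hk hl
      unfold DynkinAdj at h ⊢
      omega
  en_fire := fun {s i j} hi hj hij => by
    refine ⟨fun l hl => ?_, ?_, ?_⟩
    · rcases eq_mid_or_eq_liftLetter i with rfl | ⟨k, rfl⟩
      · simpa [letterP_mid] using hj.1 l hl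
      · have hk := letterP_eq_some_iff_liftLetter.2 (rfl : liftLetter n k = _)
        have hkl : k ≠ l := by
          rintro rfl
          exact hij (letterP_eq_some_iff_liftLetter.1 hl).symm
        have h : (DynkinQuiver.reflect k s.1).IsSink l :=
          (DynkinQuiver.firing _).en_fire (hi.1 k hk) (hj.1 l hl) hkl
        simpa [hk] using h
    · rintro rfl
      have h1 : ¬ DynkinAdj i (mid n) := fun h => by
        simpa [hi.2.2 h] using hj.2.1 rfl
      simpa [hij, h1] using hj.2.1 rfl
    · intro h
      -- The two neighbours of `n + 1` have adjacent images in `A_{2n}`, which cannot both be sinks.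
      have h1 : ¬ DynkinAdj i (mid n) := fun h' => by
        rcases eq_mid_or_eq_liftLetter i with rfl | ⟨k, rfl⟩
        · exact not_dynkinAdj_self _ h'
        rcases eq_mid_or_eq_liftLetter j with rfl | ⟨l, rfl⟩
        · exact not_dynkinAdj_self _ h
        have hk := letterP_eq_some_iff_liftLetter.2 (rfl : liftLetter n k = _)
        have hl := letterP_eq_some_iff_liftLetter.2 (rfl : liftLetter n l = _)
        have hne : (liftLetter n k : ℕ) ≠ liftLetter n l := fun e => hij (Fin.ext e)
        refine (DynkinQuiver.firing _).not_adj (hi.1 k hk) (hj.1 l hl) ?_ ?_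
        · rintro rfl; exact hij rfl
        · rw [letterP_eq_some_iff] at hk hl
          rw [dynkinAdj_mid] at h h'
          unfold DynkinAdj
          omega
      simp [h1, hj.2.2 h]
  fire_comm := fun {s i j} hi hj => by
    refine Prod.ext ?_ ?_
    · change (letterP n j).elim ((letterP n i).elim s.1 _) _ =
        (letterP n i).elim ((letterP n j).elim s.1 _) _
      cases letterP n i <;> cases letterP n j <;> simp [DynkinQuiver.reflect_comm]
    · by_cases hi1 : i = mid n
      · by_cases hj1 : j = mid n
        · simp [hi1, hj1]
        · have : ¬ DynkinAdj j (mid n) := fun h => by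
            simpa [hj.2.2 h] using hi.2.1 hi1
          simp [hi1, hj1, this]
      · by_cases hj1 : j = mid n
        · have : ¬ DynkinAdj i (mid n) := fun h => by
            simpa [hi.2.2 h] using hj.2.1 hj1
          simp [hi1, hj1, this]
        · by_cases hi2 : DynkinAdj i (mid n) <;> simp [hi1, hj1, hi2]
  en_of_fire := fun {s i j} hi hj hij hadj => by
    rcases eq_mid_or_eq_liftLetter i with rfl | ⟨k, rfl⟩
    · refine ⟨?_, fun h => absurd h.symm hij, fun h => absurd h.symm hadj⟩
      simpa [letterP_mid] using hj.1
    have hk := letterP_eq_some_iff_liftLetter.2 (rfl : liftLetter n k = _)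
    rcases eq_mid_or_eq_liftLetter j with rfl | ⟨l, rfl⟩
    · have := hj.2.1 rfl
      simp only [hij, hadj, if_false] at this
      exact ⟨by simp [letterP_mid], fun _ => this, fun h => absurd h (not_dynkinAdj_self _)⟩
    have hl := letterP_eq_some_iff_liftLetter.2 (rfl : liftLetter n l = _)
    -- The letters `n` and `n + 2` commute although their images are adjacent. The flag excludes
    -- this case: firing one neighbour of `n + 1` disables both until `n + 1` is fired.
    have hnot : ¬ (DynkinAdj (liftLetter n k) (mid n) ∧ DynkinAdj (liftLetter n l) (mid n)) :=
      fun h => by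
        have := hj.2.2 h.2
        simp [liftLetter_ne_mid, h.1] at this
    refine ⟨fun l' hl' => ?_, fun h => absurd h (liftLetter_ne_mid l), fun h => ?_⟩
    · obtain rfl : l = l' := by rw [hl] at hl'; exact Option.some.inj hl'
      have h1 := hj.1 l hl
      simp only [hk, Option.elim_some] at h1
      refine (DynkinQuiver.firing _).en_of_fire (hi.1 k hk) h1 ?_ ?_
      · rintro rfl; exact hij rfl
      · rw [letterP_eq_some_iff] at hk hl
        rw [dynkinAdj_mid, dynkinAdj_mid] at hnot
        unfold DynkinAdj at hadj ⊢
        omega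
    · have := hj.2.2 h
      have h1 : ¬ DynkinAdj (liftLetter n k) (mid n) := fun h' => hnot ⟨h', h⟩
      simpa [liftLetter_ne_mid, h1] using this
  star_star := fun s => Prod.ext ((DynkinQuiver.firing _).star_star s.1) rfl
  en_star := fun {s i} h => by
    refine ⟨fun k hk => ?_, fun e => h.2.1 ?_, fun e => h.2.2 ?_⟩
    · rw [letterP_rev, Option.map_eq_some_iff] at hk
      obtain ⟨l, hl, rfl⟩ := hk
      exact (DynkinQuiver.firing _).en_star (h.1 l hl)
    · rw [← Fin.rev_rev i, e, mid_rev]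
    · rw [← mid_rev] at e
      exact dynkinAdj_rev.1 e
  fire_star := fun {s i} h => by
    have h1 : i.rev = mid n ↔ i = mid n := by
      rw [Fin.rev_eq_iff, mid_rev]
    have h2 : DynkinAdj i.rev (mid n) ↔ DynkinAdj i (mid n) := by
      conv_lhs => rw [← mid_rev]
      exact dynkinAdj_rev
    refine Prod.ext ?_ ?_
    · simp only [letterP_rev]
      cases letterP n i with
      | none => rfl
      | some k => exact DynkinQuiver.reflect_star _ _
    · simp only [h1, h2]

variable {n : ℕ}

lemma en_twistedFiring (s : DynkinQuiver (2 * n) × Bool) (i : Fin (2 * n + 1)) :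
    (twistedFiring n).en s i ↔ (∀ k, letterP n i = some k → s.1.IsSink k) ∧
      (i = mid n → s.2 = true) ∧ (DynkinAdj i (mid n) → s.2 = false) := Iff.rfl

lemma en_mid (s : DynkinQuiver (2 * n) × Bool) :
    (twistedFiring n).en s (mid n) ↔ s.2 = true := by
  simp [en_twistedFiring, letterP_mid, not_dynkinAdj_self]

lemma en_liftLetter (s : DynkinQuiver (2 * n) × Bool) (k : Fin (2 * n)) :
    (twistedFiring n).en s (liftLetter n k) ↔
      s.1.IsSink k ∧ (DynkinAdj (liftLetter n k) (mid n) → s.2 = false) := by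
  simp [en_twistedFiring, letterP_eq_some_iff_liftLetter.2 (rfl : liftLetter n k = _),
    liftLetter_ne_mid]

lemma fire_mid (s : DynkinQuiver (2 * n) × Bool) :
    (twistedFiring n).fire (mid n) s = (s.1, false) := by
  simp [twistedFiring, letterP_mid]

lemma fire_liftLetter (s : DynkinQuiver (2 * n) × Bool) (k : Fin (2 * n)) :
    (twistedFiring n).fire (liftLetter n k) s = (DynkinQuiver.reflect k s.1,
      if DynkinAdj (liftLetter n k) (mid n) then true else s.2) := by
  simp [twistedFiring, letterP_eq_some_iff_liftLetter.2 (rfl : liftLetter n k = _),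
    liftLetter_ne_mid]

lemma run_twistedFiring_fst (s : DynkinQuiver (2 * n) × Bool) (w : Word (2 * n + 1)) :
    ((twistedFiring n).run s w).1 = (DynkinQuiver.firing (2 * n)).run s.1 (wordP n w) := by
  induction w generalizing s with
  | nil => rfl
  | cons i w ih =>
    rw [FiringSystem.run, ih]
    rcases eq_mid_or_eq_liftLetter i with rfl | ⟨k, rfl⟩
    · rw [wordP_mid_cons, fire_mid]
    · rw [wordP_liftLetter_cons, fire_liftLetter]
      rfl

lemma adapted_wordP {s : DynkinQuiver (2 * n) × Bool} {w : Word (2 * n + 1)}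
    (h : (twistedFiring n).Adapted s w) :
    (DynkinQuiver.firing (2 * n)).Adapted s.1 (wordP n w) := by
  induction w generalizing s with
  | nil => trivial
  | cons i w ih =>
    have := ih h.2
    rcases eq_mid_or_eq_liftLetter i with rfl | ⟨k, rfl⟩
    · rw [wordP_mid_cons]
      rwa [fire_mid] at this
    · rw [wordP_liftLetter_cons]
      rw [fire_liftLetter] at this
      exact ⟨((en_liftLetter s k).1 h.1).1, this⟩

/-- `P` does not respect commutation in general, since it makes `n` and `n + 2` adjacent. For
adapted words it suffices that the images are adapted to the same quiver and have the same letters.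
-/
lemma commClass_wordP_congr {s : DynkinQuiver (2 * n) × Bool} {v w : Word (2 * n + 1)}
    (hv : (twistedFiring n).Adapted s v) (h : commClass v = commClass w) :
    commClass (wordP n v) = commClass (wordP n w) :=
  (DynkinQuiver.firing _).commClass_eq_of_perm (adapted_wordP hv)
    (adapted_wordP (((twistedFiring n).adapted_congr h).1 hv))
    (wordP_perm (perm_of_commClass_eq h))

/-- In an adapted word the letter `n + 1` and its neighbours alternate. -/
lemma countP_add_flag {s : DynkinQuiver (2 * n) × Bool} {w : Word (2 * n + 1)}
    (h : (twistedFiring n).Adapted s w) :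
    s.2.toNat + w.countP (fun i => decide (DynkinAdj i (mid n))) =
      ((twistedFiring n).run s w).2.toNat + w.count (mid n) := by
  induction w generalizing s with
  | nil => rfl
  | cons i w ih =>
    have h1 := ih h.2
    rw [FiringSystem.run]
    rcases eq_mid_or_eq_liftLetter i with rfl | ⟨k, rfl⟩
    · have h2 := (en_mid s).1 h.1
      rw [fire_mid] at h1 ⊢
      rw [List.countP_cons_of_neg (by simpa using not_dynkinAdj_self _), List.count_cons_self, h2]
      simp only [Bool.toNat_false, Bool.toNat_true] at h1 ⊢
      omega
    · have h2 := ((en_liftLetter s k).1 h.1).2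
      rw [fire_liftLetter] at h1 ⊢
      rw [List.count_cons_of_ne (liftLetter_ne_mid k)]
      by_cases h3 : DynkinAdj (liftLetter n k) (mid n)
      · rw [List.countP_cons_of_pos (by simpa using h3), h2 h3]
        simp only [h3, if_true, Bool.toNat_false, Bool.toNat_true] at h1 ⊢
        omega
      · rw [List.countP_cons_of_neg (by simpa using h3)]
        simp only [h3, if_false] at h1 ⊢
        exact h1

/-- `P` forgets only the number of letters `n + 1`, and alternation recovers it from the number of
neighbours and the flags at both ends. -/
lemma perm_of_wordP_perm {s : DynkinQuiver (2 * n) × Bool} {v w : Word (2 * n + 1)}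
    (hv : (twistedFiring n).Adapted s v) (hw : (twistedFiring n).Adapted s w)
    (hr : ((twistedFiring n).run s v).2 = ((twistedFiring n).run s w).2)
    (h : (wordP n v).Perm (wordP n w)) : v.Perm w := by
  have hN (u : Word (2 * n + 1)) : u.countP (fun i => decide (DynkinAdj i (mid n))) =
      ((wordP n u).map (liftLetter n)).countP (fun i => decide (DynkinAdj i (mid n))) := by
    rw [(perm_wordP_append u).countP_eq, List.countP_append, List.countP_replicate]
    simp [not_dynkinAdj_self]
  have h1 := countP_add_flag hv
  have h2 := countP_add_flag hw
  have h3 := (h.map (liftLetter n)).countP_eq fun i => decide (DynkinAdj i (mid n))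
  have h4 : v.count (mid n) = w.count (mid n) := by
    rw [hN, hr] at h1
    rw [hN] at h2
    omega
  refine (perm_wordP_append v).trans (List.Perm.trans ?_ (perm_wordP_append w).symm)
  rw [h4]
  exact (h.map _).append_right _

/-! ### Alternating products of a word and its dual -/

/-- The word `v v^∨ v v^∨ ⋯` with `k` factors. -/
def alternating {m : ℕ} (v : Word m) (k : ℕ) : Word m :=
  ((List.range k).map fun j => v.map (Fin.rev^[j])).flatten

lemma alternating_succ {m : ℕ} (v : Word m) (k : ℕ) :
    alternating v (k + 1) = alternating v k ++ v.map (Fin.rev^[k]) := by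
  simp [alternating, List.range_succ]

lemma length_alternating {m : ℕ} (v : Word m) (k : ℕ) :
    (alternating v k).length = k * v.length := by
  induction k with
  | zero => simp [alternating]
  | succ k ih => rw [alternating_succ, List.length_append, ih, List.length_map, Nat.succ_mul]

lemma wordProd_map_rev {m : ℕ} (w : Word m) :
    wordProd (w.map Fin.rev) = Fin.revPerm * wordProd w * Fin.revPerm := by
  induction w with
  | nil => simp [revPerm_mul_revPerm]
  | cons i w ih =>
    rw [List.map_cons, wordProd_cons, ih, simpleRefl_rev, wordProd_cons]
    calc _ = Fin.revPerm * simpleRefl i * (Fin.revPerm * Fin.revPerm) * wordProd w *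
          Fin.revPerm := by simp only [mul_assoc]
      _ = _ := by rw [revPerm_mul_revPerm, mul_one, mul_assoc Fin.revPerm]

lemma map_iterate_rev_succ {m : ℕ} (w : Word m) (k : ℕ) :
    w.map (Fin.rev^[k + 1]) = (w.map (Fin.rev^[k])).map Fin.rev := by
  rw [List.map_map, Function.iterate_succ']

lemma wordProd_map_iterate_rev {m : ℕ} (w : Word m) (k : ℕ) :
    wordProd (w.map (Fin.rev^[k])) = Fin.revPerm ^ k * wordProd w * Fin.revPerm ^ k := by
  induction k with
  | zero => simp
  | succ k ih =>
    rw [map_iterate_rev_succ, wordProd_map_rev, ih]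
    calc _ = (Fin.revPerm * Fin.revPerm ^ k) * wordProd w * (Fin.revPerm ^ k * Fin.revPerm) := by
          simp only [mul_assoc]
      _ = _ := by rw [← pow_succ', ← pow_succ]

/-- The conjugations by `w₀` in successive factors telescope. -/
lemma wordProd_alternating {m : ℕ} (v : Word m) (k : ℕ) :
    wordProd (alternating v k) = (wordProd v * Fin.revPerm) ^ k * Fin.revPerm ^ k := by
  induction k with
  | zero => rfl
  | succ k ih =>
    have h : (Fin.revPerm : Equiv.Perm (Fin (m + 1))) ^ k * Fin.revPerm ^ k = 1 := by
      rw [← (Commute.refl _).mul_pow, revPerm_mul_revPerm, one_pow]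
    rw [alternating_succ, wordProd_append, ih, wordProd_map_iterate_rev]
    calc _ = (wordProd v * Fin.revPerm) ^ k *
          ((Fin.revPerm : Equiv.Perm (Fin (m + 1))) ^ k * Fin.revPerm ^ k) * wordProd v *
            Fin.revPerm ^ k := by simp only [mul_assoc]
      _ = (wordProd v * Fin.revPerm) ^ k * wordProd v * Fin.revPerm ^ k := by rw [h, mul_one]
      _ = _ := by
        rw [pow_succ (wordProd v * Fin.revPerm), pow_succ' Fin.revPerm k]
        calc _ = (wordProd v * Fin.revPerm) ^ k * wordProd v * 1 * Fin.revPerm ^ k := by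
              rw [mul_one]
          _ = _ := by rw [← revPerm_mul_revPerm]; simp only [mul_assoc]

namespace FiringSystem

variable {m : ℕ} {X : Type*} (F : FiringSystem m X)

lemma adapted_map_rev {x : X} {w : Word m} (h : F.Adapted x w) :
    F.Adapted (F.star x) (w.map Fin.rev) ∧
      F.run (F.star x) (w.map Fin.rev) = F.star (F.run x w) := by
  induction w generalizing x with
  | nil => exact ⟨trivial, rfl⟩
  | cons i w ih =>
    have := ih h.2
    rw [← F.fire_star h.1] at this
    exact ⟨⟨F.en_star h.1, this.1⟩, this.2⟩

lemma adapted_map_iterate_rev {x : X} {v : Word m} (hv : F.Adapted x v)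
    (hr : F.run x v = F.star x) (k : ℕ) :
    F.Adapted (F.star^[k] x) (v.map (Fin.rev^[k])) ∧
      F.run (F.star^[k] x) (v.map (Fin.rev^[k])) = F.star^[k + 1] x := by
  induction k with
  | zero => simpa using ⟨hv, hr⟩
  | succ k ih =>
    rw [map_iterate_rev_succ, Function.iterate_succ_apply', Function.iterate_succ_apply' _ (k + 1)]
    have := F.adapted_map_rev ih.1
    rw [ih.2] at this
    exact this

lemma adapted_alternating {x : X} {v : Word m} (hv : F.Adapted x v)
    (hr : F.run x v = F.star x) (k : ℕ) :
    F.Adapted x (alternating v k) ∧ F.run x (alternating v k) = F.star^[k] x := by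
  induction k with
  | zero => exact ⟨trivial, rfl⟩
  | succ k ih =>
    obtain ⟨h1, h2⟩ := ih
    have := F.adapted_map_iterate_rev hv hr k
    rw [alternating_succ, adapted_append, run_append, h2]
    exact ⟨⟨h1, this.1⟩, this.2⟩

end FiringSystem

/-! ### The base word -/

/-- The word `1 2 ⋯ t`. -/
def initialWord (m t : ℕ) (h : t ≤ m) : Word m :=
  List.ofFn fun j : Fin t => (⟨j, by omega⟩ : Fin m)

lemma initialWord_succ {m t : ℕ} (h : t + 1 ≤ m) :
    initialWord m (t + 1) h = initialWord m t (by omega) ++ [⟨t, h⟩] := by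
  unfold initialWord
  rw [List.ofFn_succ', List.concat_eq_append]
  rfl

lemma wordProd_initialWord {m t : ℕ} (h : t ≤ m) (x : Fin (m + 1)) :
    (wordProd (initialWord m t h) x : ℕ) =
      if (x : ℕ) < t then (x : ℕ) + 1 else if (x : ℕ) = t then 0 else x := by
  induction t generalizing x with
  | zero =>
    change (x : ℕ) = _
    split_ifs <;> omega
  | succ t ih =>
    rw [initialWord_succ, wordProd_append, Equiv.Perm.mul_apply, ih]
    simp only [wordProd_cons, wordProd_nil, mul_one, simpleRefl, Equiv.swap_apply_def,
      Fin.ext_iff, Fin.val_castSucc, Fin.val_succ]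
    split_ifs <;> simp_all <;> omega

/-- An alternating product of `2n + 1` words `1 ⋯ t` and their duals is a reduced word of `w₀`. -/
lemma isLongestWord_alternating {m n t : ℕ} (h : t ≤ m) (htn : t + n = m)
    (hm : m = 2 * n ∨ m = 2 * n + 1) :
    IsLongestWord (alternating (initialWord m t h) (2 * n + 1)) := by
  set f : Equiv.Perm (Fin (m + 1)) := wordProd (initialWord m t h) * Fin.revPerm with hf
  have hfx (x : Fin (m + 1)) : (f x : ℕ) =
      if (x : ℕ) < n then m - x else if (x : ℕ) = n then 0 else m + 1 - x := by
    rw [hf, Equiv.Perm.mul_apply, wordProd_initialWord, Fin.revPerm_apply, Fin.val_rev]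
    split_ifs <;> omega
  -- The orbit of `0` under `f` is `0, m, 1, m - 1, …, n`, a cycle of length `2 * n + 1`.
  have heven (j : ℕ) (hj : j ≤ n) : (((f ^ (2 * j)) 0 : Fin (m + 1)) : ℕ) = j := by
    induction j with
    | zero => simp
    | succ j ih =>
      have h1 := ih (by omega)
      rw [Nat.mul_succ, pow_add, (Commute.pow_pow_self f _ _).eq, Equiv.Perm.mul_apply, pow_two,
        Equiv.Perm.mul_apply, hfx, hfx, h1]
      split_ifs <;> omega
  have hodd (j : ℕ) (hj : j < n) : (((f ^ (2 * j + 1)) 0 : Fin (m + 1)) : ℕ) = m - j := by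
    rw [pow_succ', Equiv.Perm.mul_apply, hfx, heven j hj.le, if_pos hj]
  have hzero : (f ^ (2 * n + 1)) 0 = 0 := by
    apply Fin.ext
    rw [pow_succ', Equiv.Perm.mul_apply, hfx, heven n le_rfl]
    simp
  have horb (a : ℕ) : (f ^ (2 * n + 1)) ((f ^ a) 0) = (f ^ a) 0 := by
    rw [← Equiv.Perm.mul_apply, (Commute.pow_pow_self f _ _).eq, Equiv.Perm.mul_apply, hzero]
  have hone : f ^ (2 * n + 1) = 1 := by
    ext x : 1
    rw [Equiv.Perm.one_apply]
    by_cases h1 : (x : ℕ) ≤ n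
    · have : x = (f ^ (2 * (x : ℕ))) 0 := Fin.ext (heven x h1).symm
      rw [this]
      exact horb _
    · by_cases h2 : m - (x : ℕ) < n
      · have : x = (f ^ (2 * (m - (x : ℕ)) + 1)) 0 := by
          apply Fin.ext
          rw [hodd _ h2]
          omega
        rw [this]
        exact horb _
      -- The only point that can lie off the orbit is `n + 1`, when `m = 2 * n + 1`; it is fixed by
      -- `f`.
      · refine Function.IsFixedPt.perm_pow (e := f) (Fin.ext ?_) _
        rw [hfx]
        split_ifs <;> omega
  rw [isLongestWord_iff]
  constructor
  · rw [wordProd_alternating, ← hf, hone, one_mul, pow_succ, pow_mul, pow_two,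
      revPerm_mul_revPerm, one_pow, one_mul]
  -- The length `(2 * n + 1) * t` equals `m * (m + 1) / 2` in both cases, which makes the word
  -- reduced.
  · have h1 := two_mul_inv_revPerm m
    rw [length_alternating, initialWord, List.length_ofFn]
    rcases hm with rfl | rfl
    · obtain rfl : t = n := by omega
      nlinarith
    · obtain rfl : t = n + 1 := by omega
      nlinarith

variable {n : ℕ}

lemma baseBlock_eq (n : ℕ) : baseBlock n = initialWord (2 * n + 1) (n + 1) (by omega) := rfl

lemma baseWord_eq (n : ℕ) : baseWord n = alternating (baseBlock n) (2 * n + 1) := rfl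

lemma wordP_alternating (v : Word (2 * n + 1)) (k : ℕ) :
    wordP n (alternating v k) = alternating (wordP n v) k := by
  have h (j : ℕ) : wordP n (v.map (Fin.rev^[j])) = (wordP n v).map (Fin.rev^[j]) := by
    induction j with
    | zero => simp
    | succ j ih => rw [map_iterate_rev_succ, map_iterate_rev_succ, wordP_map_rev, ih]
  induction k with
  | zero => rfl
  | succ k ih => rw [alternating_succ, alternating_succ, wordP_append, ih, h]

lemma wordP_initialWord {t : ℕ} (h : t ≤ n) :
    wordP n (initialWord (2 * n + 1) t (by omega)) = initialWord (2 * n) t (by omega) := by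
  induction t with
  | zero => rfl
  | succ t ih =>
    rw [initialWord_succ, initialWord_succ, wordP_append, ih (by omega)]
    refine congrArg _ (wordP_cons_of_eq_some ?_ _)
    rw [letterP_eq_some_iff]
    exact Or.inl ⟨by simp only; omega, rfl⟩

lemma wordP_baseBlock (n : ℕ) : wordP n (baseBlock n) = initialWord (2 * n) n (by omega) := by
  rw [baseBlock_eq, initialWord_succ, wordP_append, wordP_initialWord le_rfl]
  have : (⟨n, by omega⟩ : Fin (2 * n + 1)) = mid n := rfl
  rw [this, wordP_mid_cons, wordP_nil, List.append_nil]

lemma isLongestWord_baseWord (n : ℕ) : IsLongestWord (baseWord n) :=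
  isLongestWord_alternating (by omega) (by omega) (Or.inr rfl)

lemma isLongestWord_wordP_baseWord (n : ℕ) : IsLongestWord (wordP n (baseWord n)) := by
  rw [baseWord_eq, wordP_alternating, wordP_baseBlock]
  exact isLongestWord_alternating (by omega) (by omega) (Or.inl rfl)

/-- The quiver to which the image of the base word is adapted. -/
def baseQuiver (n : ℕ) : DynkinQuiver (2 * n) := DynkinQuiver.ofUp {i | n ≤ (i : ℕ)}

/-- Each interior edge met so far has been reversed twice, so only the edge between the last fired
vertex and the next one differs from the start. -/
lemma adapted_initialWord {t : ℕ} (h : t ≤ n) :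
    (DynkinQuiver.firing (2 * n)).Adapted (baseQuiver n) (initialWord (2 * n) t (by omega)) ∧
    (DynkinQuiver.firing (2 * n)).run (baseQuiver n) (initialWord (2 * n) t (by omega)) =
      DynkinQuiver.ofUp {i | n ≤ (i : ℕ) ∨ (i : ℕ) + 1 = t} := by
  induction t with
  | zero =>
    refine ⟨trivial, ?_⟩
    simp only [Nat.succ_ne_zero, or_false]
    rfl
  | succ t ih =>
    obtain ⟨h1, h2⟩ := ih (by omega)
    rw [initialWord_succ, FiringSystem.adapted_append, FiringSystem.run_append, h2]
    refine ⟨⟨h1, ?_, trivial⟩, ?_⟩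
    · rintro j (⟨h3, h4⟩ | ⟨h3, h4⟩)
      · simp only [Set.mem_ofPred_eq] at h3 h4
        omega
      · simp only [Set.mem_ofPred_eq] at h3 h4
        omega
    · change DynkinQuiver.reflect _ _ = _
      ext a b
      simp only [DynkinQuiver.reflect_arrow, DynkinQuiver.ofUp, Set.mem_ofPred_eq, Fin.ext_iff]
      omega

lemma star_baseQuiver (n : ℕ) :
    (baseQuiver n).star = DynkinQuiver.ofUp {i | n ≤ (i : ℕ) ∨ (i : ℕ) + 1 = n} := by
  ext a b
  simp only [DynkinQuiver.star_arrow, baseQuiver, DynkinQuiver.ofUp, Set.mem_ofPred_eq,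
    Fin.val_rev]
  omega

lemma adapted_initialWord_twisted {t : ℕ} (h : t ≤ n) :
    (twistedFiring n).Adapted (baseQuiver n, false) (initialWord (2 * n + 1) t (by omega)) ∧
    ((twistedFiring n).run (baseQuiver n, false) (initialWord (2 * n + 1) t (by omega))).2 =
      decide (t = n ∧ 0 < n) := by
  induction t with
  | zero =>
    refine ⟨trivial, ?_⟩
    change false = _
    rw [eq_comm, decide_eq_false_iff_not]
    omega
  | succ t ih =>
    obtain ⟨h1, h2⟩ := ih (by omega)
    have ha := (adapted_initialWord h).1
    rw [initialWord_succ, FiringSystem.adapted_append] at ha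
    have hl : (⟨t, by omega⟩ : Fin (2 * n + 1)) = liftLetter n ⟨t, by omega⟩ := by
      rw [← letterP_eq_some_iff_liftLetter, letterP_eq_some_iff]
      exact Or.inl ⟨by simp only; omega, rfl⟩
    have hadj : DynkinAdj (⟨t, by omega⟩ : Fin (2 * n + 1)) (mid n) ↔ t + 1 = n := by
      rw [dynkinAdj_mid]
      simp only
      omega
    have hf : ((twistedFiring n).run (baseQuiver n, false)
        (initialWord (2 * n + 1) t (by omega))).2 = false := by
      rw [h2, decide_eq_false_iff_not]
      omega
    rw [initialWord_succ, FiringSystem.adapted_append, FiringSystem.run_append]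
    refine ⟨⟨h1, ?_, trivial⟩, ?_⟩
    · rw [hl, en_liftLetter, run_twistedFiring_fst, wordP_initialWord (by omega)]
      exact ⟨ha.2.1, fun _ => hf⟩
    · rw [FiringSystem.run, FiringSystem.run, hl, fire_liftLetter, ← hl]
      simp only [hadj, hf]
      split_ifs with h3
      · simp [h3]; omega
      · simp [h3]

lemma adapted_baseBlock (hn : 1 ≤ n) :
    (twistedFiring n).Adapted (baseQuiver n, false) (baseBlock n) ∧
    (twistedFiring n).run (baseQuiver n, false) (baseBlock n) =
      (twistedFiring n).star (baseQuiver n, false) := by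
  obtain ⟨h1, h2⟩ := adapted_initialWord_twisted (le_refl n)
  have hm : (⟨n, by omega⟩ : Fin (2 * n + 1)) = mid n := rfl
  rw [baseBlock_eq, initialWord_succ, FiringSystem.adapted_append, FiringSystem.run_append, hm]
  refine ⟨⟨h1, ?_, trivial⟩, ?_⟩
  · rw [en_mid, h2]
    simpa using Nat.pos_of_ne_zero (by omega)
  · rw [FiringSystem.run, FiringSystem.run, fire_mid, run_twistedFiring_fst,
      wordP_initialWord le_rfl, (adapted_initialWord le_rfl).2, ← star_baseQuiver]
    rfl

lemma good_baseWord (hn : 1 ≤ n) :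
    (twistedFiring n).Good (baseQuiver n, false) (baseWord n) := by
  obtain ⟨h1, h2⟩ := adapted_baseBlock hn
  obtain ⟨h3, h4⟩ := (twistedFiring n).adapted_alternating h1 h2 (2 * n + 1)
  refine ⟨h3, ?_, isLongestWord_baseWord n⟩
  -- Each block dualizes the state, and the number of blocks is odd.
  rw [baseWord_eq, h4, Function.iterate_succ_apply']
  have : (twistedFiring n).star^[2] = id := funext (twistedFiring n).star_star
  rw [Function.iterate_mul, this, Function.iterate_id, id]

lemma Good.wordP {s : DynkinQuiver (2 * n) × Bool} {w : Word (2 * n + 1)}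
    (h : (twistedFiring n).Good s w) (hl : IsLongestWord (wordP n w)) :
    (DynkinQuiver.firing (2 * n)).Good s.1 (TwistedAdapted.wordP n w) :=
  ⟨adapted_wordP h.adapted, by rw [← run_twistedFiring_fst, h.run_eq]; rfl, hl⟩

/-! ### The two cluster points -/

lemma FiringSystem.exists_classes {m : ℕ} {X : Type*} {F : FiringSystem m X}
    (h : ∀ x, ∃ w, F.Good x w) :
    ∃ A : X → CommClass m, ∀ x w, F.Good x w ↔ commClass w = A x := by
  choose f hf using h
  exact ⟨fun x => commClass (f x), fun x w =>
    ⟨fun hw => hw.commClass_eq (hf x).adapted (hf x).isLongestWord, fun hw => (hf x).congr hw.symm⟩⟩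

variable {n : ℕ}

lemma exists_good (hn : 1 ≤ n) (Q : DynkinQuiver (2 * n)) :
    ∃ w, (DynkinQuiver.firing (2 * n)).Good Q w := by
  have h := Good.wordP (good_baseWord hn) (isLongestWord_wordP_baseWord n)
  obtain ⟨w, hw, -⟩ := h.exists_good (DynkinQuiver.reflTransGen_step h _ Q)
  exact ⟨w, hw⟩

lemma isClassOf_iff (hn : 1 ≤ n) (Q : DynkinQuiver (2 * n)) (c : CommClass (2 * n)) :
    Q.IsClassOf c ↔ ∃ w, (DynkinQuiver.firing (2 * n)).Good Q w ∧ commClass w = c := by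
  constructor
  · rintro ⟨w, hl, ha, rfl⟩
    obtain ⟨v, hv⟩ := exists_good hn Q
    exact ⟨w, hv.of_adapted ((Q.adapted_iff w).1 ha) hl, rfl⟩
  · rintro ⟨w, hw, rfl⟩
    exact ⟨w, hw.isLongestWord, (Q.adapted_iff w).2 hw.adapted, rfl⟩

lemma rCluster_eq_adaptedCluster (hn : 1 ≤ n) {d : CommClass (2 * n)}
    (hd : d ∈ adaptedCluster (2 * n)) : rCluster d = adaptedCluster (2 * n) := by
  obtain ⟨Q, hQ⟩ := hd
  obtain ⟨w, hw, rfl⟩ := (isClassOf_iff hn Q d).1 hQ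
  ext c
  constructor
  · intro hc
    obtain ⟨R, v, hv, rfl⟩ := hw.of_mem_rCluster hc
    exact ⟨R, (isClassOf_iff hn R _).2 ⟨v, hv, rfl⟩⟩
  · rintro ⟨R, hR⟩
    obtain ⟨v, hv, rfl⟩ := (isClassOf_iff hn R c).1 hR
    obtain ⟨u, hu, hc⟩ := hw.exists_good (DynkinQuiver.reflTransGen_step hw Q R)
    rwa [hv.commClass_eq hu.adapted hu.isLongestWord]

/-- A reflection at a sink of the quiver lifts to twisted quivers with any flag. -/
lemma reflTransGen_twisted_step {Q R : DynkinQuiver (2 * n)}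
    (h : (DynkinQuiver.firing (2 * n)).Step Q R) (b : Bool) :
    ∃ b', Relation.ReflTransGen (twistedFiring n).Step (Q, b') (R, b) := by
  obtain ⟨k, hk, rfl⟩ := h
  by_cases hadj : DynkinAdj (liftLetter n k) (mid n)
  · have h1 : (twistedFiring n).Step (Q, false) (DynkinQuiver.reflect k Q, true) :=
      ⟨liftLetter n k, (en_liftLetter _ _).2 ⟨hk, fun _ => rfl⟩, by
        rw [fire_liftLetter, if_pos hadj]⟩
    have h2 : (twistedFiring n).Step (DynkinQuiver.reflect k Q, true)
        (DynkinQuiver.reflect k Q, false) :=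
      ⟨mid n, (en_mid _).2 rfl, by rw [fire_mid]⟩
    cases b
    · exact ⟨false, .tail (.single h1) h2⟩
    · exact ⟨false, .single h1⟩
  · exact ⟨b, .single ⟨liftLetter n k, (en_liftLetter _ _).2 ⟨hk, fun h => absurd h hadj⟩, by
      rw [fire_liftLetter, if_neg hadj]; rfl⟩⟩

/-- Around an occurrence of `n + 1` in the base word both flags appear over one quiver; from there,
lifted firings reach every quiver with either flag. -/
lemma exists_good_twisted (hn : 1 ≤ n) (s : DynkinQuiver (2 * n) × Bool) :
    ∃ w, (twistedFiring n).Good s w ∧ commClass w ∈ twistedCluster n := by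
  have hg := good_baseWord hn
  have hr {s t : DynkinQuiver (2 * n) × Bool}
      (h : Relation.ReflTransGen (twistedFiring n).Step s t) :
      (∃ w, (twistedFiring n).Good s w ∧ commClass w ∈ twistedCluster n) →
      ∃ w, (twistedFiring n).Good t w ∧ commClass w ∈ twistedCluster n := by
    induction h with
    | refl => exact id
    | tail _ h ih => exact fun h' => FiringSystem.Good.exists_good_of_step h (ih h')
  obtain ⟨u, v, huv⟩ := List.append_of_mem (hg.isLongestWord.mem (mid n))
  have ha := hg.adapted
  rw [huv, FiringSystem.adapted_append] at ha
  set t := (twistedFiring n).run (baseQuiver n, false) u with ht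
  have htrue : t.2 = true := (en_mid t).1 ha.2.1
  have h1 := hr (FiringSystem.reflTransGen_step_run ha.1) ⟨_, hg, self_mem_rCluster _⟩
  rw [← ht] at h1
  have h2 := hr (.single ⟨mid n, ha.2.1, (fire_mid t).symm⟩) h1
  have hstart (b : Bool) : ∃ w, (twistedFiring n).Good (t.1, b) w ∧
      commClass w ∈ twistedCluster n := by
    cases b
    · exact h2
    · rwa [← htrue]
  obtain ⟨w, hw⟩ := exists_good hn t.1
  have hall {R : DynkinQuiver (2 * n)}
      (hR : Relation.ReflTransGen (DynkinQuiver.firing (2 * n)).Step t.1 R) :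
      ∀ b, ∃ w, (twistedFiring n).Good (R, b) w ∧ commClass w ∈ twistedCluster n := by
    induction hR with
    | refl => exact hstart
    | tail _ h ih =>
      intro b
      obtain ⟨b', hb'⟩ := reflTransGen_twisted_step h b
      exact hr hb' (ih b')
  exact hall (DynkinQuiver.reflTransGen_step hw t.1 s.1) s.2

lemma mem_twistedCluster_iff (hn : 1 ≤ n) (c : CommClass (2 * n + 1)) :
    c ∈ twistedCluster n ↔ ∃ s w, (twistedFiring n).Good s w ∧ commClass w = c := by
  constructor
  · exact fun hc => (good_baseWord hn).of_mem_rCluster hc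
  · rintro ⟨s, w, hw, rfl⟩
    obtain ⟨v, hv, hc⟩ := exists_good_twisted hn s
    rwa [hw.commClass_eq hv.adapted hv.isLongestWord]

lemma isLongestWord_wordP_rotate (i : Fin (2 * n + 1)) (w : Word (2 * n + 1)) :
    IsLongestWord (wordP n (i :: w)) ↔ IsLongestWord (wordP n (w ++ [i.rev])) := by
  rw [wordP_append]
  cases h : letterP n i with
  | none =>
    obtain rfl := letterP_eq_none_iff.1 h
    rw [mid_rev, wordP_mid_cons, wordP_mid_cons, wordP_nil, List.append_nil]
  | some k =>
    have h' : letterP n i.rev = some k.rev := by rw [letterP_rev, h, Option.map_some]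
    rw [wordP_cons_of_eq_some h, wordP_cons_of_eq_some h', wordP_nil]
    exact isLongestWord_rotate k _

/-- The property holds for the base word and is transported by rotations, because `P` intertwines
them: rotating `n + 1` has no effect below. -/
lemma isLongestWord_wordP (hn : 1 ≤ n) {c : CommClass (2 * n + 1)} (hc : c ∈ twistedCluster n)
    {w : Word (2 * n + 1)} (hw : commClass w = c) : IsLongestWord (wordP n w) := by
  have hcongr {v w : Word (2 * n + 1)} (hv : commClass v ∈ twistedCluster n)
      (h : commClass v = commClass w) :
      IsLongestWord (wordP n v) ↔ IsLongestWord (wordP n w) := by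
    obtain ⟨s, u, hu, hu'⟩ := (mem_twistedCluster_iff hn _).1 hv
    exact isLongestWord_congr (commClass_wordP_congr (hu.congr hu').adapted h)
  induction hc generalizing w with
  | refl =>
    exact (hcongr (self_mem_rCluster _) hw.symm).1 (isLongestWord_wordP_baseWord n)
  | @tail c d hc h ih =>
    have hd : commClass w ∈ twistedCluster n := hw ▸ Relation.ReflTransGen.tail hc h
    obtain ⟨i, v, ⟨h1, h2⟩ | ⟨h1, h2⟩⟩ := h
    · rw [hcongr hd (hw.trans h2), ← isLongestWord_wordP_rotate]
      exact ih h1.symm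
    · rw [hcongr hd (hw.trans h2), isLongestWord_wordP_rotate, Fin.rev_rev]
      exact ih h1.symm

/-! ### The flag as source or sink condition -/

lemma isSink_mid_iff {s : DynkinQuiver (2 * n) × Bool} {w : Word (2 * n + 1)}
    (hw : (twistedFiring n).Good s w) : IsSink (mid n) (commClass w) ↔ s.2 = true := by
  rw [hw.isSink_iff, en_mid]

/-- Firing `n + 1` clears the flag, and every state with cleared flag arises by firing `n + 1` from
the same quiver with the flag set. -/
lemma isSource_mid_iff (hn : 1 ≤ n) {s : DynkinQuiver (2 * n) × Bool} {w : Word (2 * n + 1)}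
    (hw : (twistedFiring n).Good s w) : IsSource (mid n) (commClass w) ↔ s.2 = false := by
  constructor
  · intro h
    obtain ⟨y, -, rfl⟩ := hw.exists_of_isSource h
    rw [mid_rev, fire_mid]
  · intro h
    obtain ⟨v, hv, -⟩ := exists_good_twisted hn (s.1, true)
    have hs : (twistedFiring n).fire (mid n).rev (s.1, true) = s := by
      rw [mid_rev, fire_mid, ← h]
    have hw' : (twistedFiring n).Good ((twistedFiring n).fire (mid n).rev (s.1, true)) w := by
      rwa [hs]
    refine FiringSystem.Good.isSource_of_en ?_ ⟨v, hv⟩ hw'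
    rw [mid_rev, en_mid]

lemma twisted_eq_of_good {s t : DynkinQuiver (2 * n) × Bool} {w : Word (2 * n + 1)}
    (hs : (twistedFiring n).Good s w) (ht : (twistedFiring n).Good t w)
    (hl : IsLongestWord (wordP n w)) : s = t := by
  refine Prod.ext (DynkinQuiver.eq_of_adapted hl ((DynkinQuiver.adapted_iff _ _).2
    (adapted_wordP hs.adapted)) ((DynkinQuiver.adapted_iff _ _).2
    (adapted_wordP ht.adapted))) ?_
  have h1 := isSink_mid_iff hs
  rw [isSink_mid_iff ht] at h1
  exact (Bool.eq_iff_iff.2 h1).symm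

/-! ### Insertion of the middle letter -/

/-- The letters of the list separated by `n + 1`, and also preceded by `n + 1` if the flag is
set. -/
def alternate (n : ℕ) (b : Bool) (l : Word (2 * n + 1)) : Word (2 * n + 1) :=
  if b then l.flatMap fun i => [mid n, i] else l.intersperse (mid n)

@[simp] lemma alternate_nil (b : Bool) : alternate n b [] = [] := by
  cases b <;> rfl

lemma alternate_false_cons (i : Fin (2 * n + 1)) (l : Word (2 * n + 1)) :
    alternate n false (i :: l) = i :: alternate n true l := by
  induction l generalizing i with
  | nil => rfl
  | cons j l ih =>
    have h := ih j
    simp only [alternate, if_true, if_false, Bool.false_eq_true] at h ⊢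
    rw [List.intersperse_cons_cons, h, List.flatMap_cons]
    rfl

lemma alternate_true_cons (i : Fin (2 * n + 1)) (l : Word (2 * n + 1)) :
    alternate n true (i :: l) = mid n :: i :: alternate n true l := rfl

/-- Insert `n + 1` into the lift of a word of type `A_{2n}` between consecutive neighbours of
`n + 1`, and before the first one if the flag is set. -/
def insertMid (n : ℕ) : Bool → Word (2 * n) → Word (2 * n + 1)
  | _, [] => []
  | b, k :: w =>
    if DynkinAdj (liftLetter n k) (mid n) then
      if b then mid n :: liftLetter n k :: insertMid n true w
      else liftLetter n k :: insertMid n true w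
    else liftLetter n k :: insertMid n b w

lemma wordP_insertMid (b : Bool) (w : Word (2 * n)) : wordP n (insertMid n b w) = w := by
  induction w generalizing b with
  | nil => rfl
  | cons k w ih =>
    unfold insertMid
    split_ifs <;> simp [ih]

lemma filter_insertMid (b : Bool) (w : Word (2 * n)) :
    (insertMid n b w).filter (fun j => decide (DynkinAdj j (mid n) ∨ j = mid n)) =
      alternate n b ((insertMid n b w).filter fun j => decide (DynkinAdj j (mid n))) := by
  induction w generalizing b with
  | nil => simp [insertMid]
  | cons k w ih =>
    simp only [Bool.decide_or] at ih
    unfold insertMid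
    split_ifs with h1 h2
    · subst h2
      simp [h1, not_dynkinAdj_self, alternate_true_cons, ih]
    · rw [Bool.not_eq_true] at h2
      subst h2
      simp [h1, alternate_false_cons, ih]
    · simp [h1, liftLetter_ne_mid, ih]

lemma isInsertion_insertMid (w : Word (2 * n)) : IsInsertion n w (insertMid n false w) :=
  ⟨wordP_insertMid false w, filter_insertMid false w⟩

/-- Strict alternation of `n + 1` with its neighbours is precisely the flag condition; the sink
conditions come from the image under `P`. -/
lemma adapted_of_filter_eq {b : Bool} {Q : DynkinQuiver (2 * n)} {u : Word (2 * n + 1)}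
    (hu : u.filter (fun j => decide (DynkinAdj j (mid n) ∨ j = mid n)) =
      alternate n b (u.filter fun j => decide (DynkinAdj j (mid n))))
    (hQ : (DynkinQuiver.firing (2 * n)).Adapted Q (wordP n u)) :
    (twistedFiring n).Adapted (Q, b) u := by
  induction u generalizing b Q with
  | nil => trivial
  | cons i u ih =>
    rcases eq_mid_or_eq_liftLetter i with rfl | ⟨k, rfl⟩
    · rw [wordP_mid_cons] at hQ
      rw [List.filter_cons_of_pos (by simp),
        List.filter_cons_of_neg (by simpa using not_dynkinAdj_self _)] at hu
      cases hl : u.filter fun j => decide (DynkinAdj j (mid n)) with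
      | nil => simp [hl] at hu
      | cons a l =>
        rw [hl] at hu
        have ha : DynkinAdj a (mid n) := by
          have : a ∈ u.filter fun j => decide (DynkinAdj j (mid n)) := by simp [hl]
          simpa using (List.mem_filter.1 this).2
        cases b with
        | false =>
          rw [alternate_false_cons, List.cons.injEq] at hu
          exact absurd (hu.1 ▸ ha) (not_dynkinAdj_self _)
        | true =>
          rw [alternate_true_cons, List.cons.injEq, ← alternate_false_cons, ← hl] at hu
          refine ⟨(en_mid _).2 rfl, ?_⟩
          rw [fire_mid]
          exact ih hu.2 hQ
    · rw [wordP_liftLetter_cons] at hQ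
      by_cases hadj : DynkinAdj (liftLetter n k) (mid n)
      · rw [List.filter_cons_of_pos (by simp [hadj]),
          List.filter_cons_of_pos (by simp [hadj])] at hu
        cases b with
        | true =>
          rw [alternate_true_cons, List.cons.injEq] at hu
          exact absurd hu.1 (liftLetter_ne_mid k)
        | false =>
          rw [alternate_false_cons, List.cons.injEq] at hu
          refine ⟨(en_liftLetter _ _).2 ⟨hQ.1, fun _ => rfl⟩, ?_⟩
          rw [fire_liftLetter, if_pos hadj]
          exact ih hu.2 hQ.2
      · rw [List.filter_cons_of_neg (by simp [hadj, liftLetter_ne_mid]),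
          List.filter_cons_of_neg (by simp [hadj])] at hu
        refine ⟨(en_liftLetter _ _).2 ⟨hQ.1, fun h => absurd h hadj⟩, ?_⟩
        rw [fire_liftLetter, if_neg hadj]
        exact ih hu hQ.2

lemma adapted_of_isInsertion {Q : DynkinQuiver (2 * n)} {w : Word (2 * n)}
    {u : Word (2 * n + 1)} (hQ : (DynkinQuiver.firing (2 * n)).Adapted Q w)
    (hu : IsInsertion n w u) : (twistedFiring n).Adapted (Q, false) u :=
  adapted_of_filter_eq hu.2 (hu.1 ▸ hQ)

/-- After an inserted word, the letter `n + 1` comes next. -/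
lemma run_of_isInsertion (hn : 1 ≤ n) {Q : DynkinQuiver (2 * n)} {w : Word (2 * n)}
    {u : Word (2 * n + 1)} (hw : IsLongestWord w)
    (hQ : (DynkinQuiver.firing (2 * n)).Adapted Q w) (hu : IsInsertion n w u) :
    ((twistedFiring n).run (Q, false) u).2 = true := by
  have h1 := countP_add_flag (adapted_of_isInsertion hQ hu)
  have h2 := congrArg List.length hu.2
  rw [List.length_intersperse, ← List.countP_eq_length_filter, ← List.countP_eq_length_filter]
    at h2
  have h3 : u.countP (fun j => decide (DynkinAdj j (mid n) ∨ j = mid n)) =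
      u.countP (fun j => decide (DynkinAdj j (mid n))) + u.count (mid n) := by
    clear h1 h2 hu
    induction u with
    | nil => rfl
    | cons i u ih =>
      simp only [List.countP_cons, List.count_cons, ih]
      by_cases hi : i = mid n
      · subst hi
        simp [not_dynkinAdj_self]
        omega
      · simp [hi]
        omega
  -- With `k` neighbours the interspersed list has length `2 * k - 1`; `k > 0` is needed since the
  -- subtraction is truncated.
  have h4 : 0 < u.countP (fun j => decide (DynkinAdj j (mid n))) := by
    have hk := hw.mem ⟨n, by omega⟩
    rw [← hu.1, wordP, List.mem_filterMap] at hk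
    obtain ⟨i, hi, hi'⟩ := hk
    refine List.countP_pos_iff.2 ⟨i, hi, ?_⟩
    rw [letterP_eq_some_iff] at hi'
    rw [decide_eq_true_iff, dynkinAdj_mid]
    simp only at hi'
    omega
  cases hb : ((twistedFiring n).run (Q, false) u).2 with
  | true => rfl
  | false =>
    rw [hb] at h1
    simp only [Bool.toNat_false] at h1
    omega

lemma commClass_eq_of_isInsertion (hn : 1 ≤ n) {Q : DynkinQuiver (2 * n)} {w : Word (2 * n)}
    {u u' : Word (2 * n + 1)} (hw : IsLongestWord w)
    (hQ : (DynkinQuiver.firing (2 * n)).Adapted Q w) (hu : IsInsertion n w u)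
    (hu' : IsInsertion n w u') : commClass u = commClass u' := by
  have h1 := adapted_of_isInsertion hQ hu
  have h2 := adapted_of_isInsertion hQ hu'
  refine (twistedFiring n).commClass_eq_of_perm h1 h2 (perm_of_wordP_perm h1 h2 ?_ ?_)
  · rw [run_of_isInsertion hn hw hQ hu, run_of_isInsertion hn hw hQ hu']
  · rw [hu.1, hu'.1]

/-- An adapted word lifting an adapted reduced word of `w₀` and leading back to the same flag is
an adapted reduced word of `w₀`. -/
lemma good_of_adapted (hn : 1 ≤ n) {s : DynkinQuiver (2 * n) × Bool} {u : Word (2 * n + 1)}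
    (hu : (twistedFiring n).Adapted s u) (hr : ((twistedFiring n).run s u).2 = s.2)
    (hl : IsLongestWord (wordP n u)) : (twistedFiring n).Good s u := by
  obtain ⟨v, hv, hc⟩ := exists_good_twisted hn s
  refine hv.congr ((twistedFiring n).commClass_eq_of_perm hv.adapted hu
    (perm_of_wordP_perm hv.adapted hu ?_ ?_))
  · rw [hv.run_eq, hr]
    rfl
  -- Both images are reduced words of `w₀` adapted to the same quiver, hence equivalent, and in
  -- particular have the same letters.
  · exact perm_of_commClass_eq ((DynkinQuiver.firing _).commClass_eq_of_wordProd_eq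
      (adapted_wordP hv.adapted) (adapted_wordP hu) (isLongestWord_wordP hn hc rfl).1 hl.1
      ((isLongestWord_wordP hn hc rfl).2.trans hl.2.symm))

lemma good_of_isInsertion (hn : 1 ≤ n) {Q : DynkinQuiver (2 * n)} {w : Word (2 * n)}
    {u : Word (2 * n + 1)} (hw : IsLongestWord w)
    (hQ : (DynkinQuiver.firing (2 * n)).Adapted Q w) (hu : IsInsertion n w u) :
    (twistedFiring n).Good (Q, true) (mid n :: u) ∧
      (twistedFiring n).Good (Q, false) (u ++ [mid n]) := by
  have h1 := adapted_of_isInsertion hQ hu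
  have h2 := run_of_isInsertion hn hw hQ hu
  constructor
  · refine good_of_adapted hn ⟨(en_mid _).2 rfl, by rwa [fire_mid]⟩ ?_ ?_
    · rwa [FiringSystem.run, fire_mid]
    · rwa [wordP_mid_cons, hu.1]
  · refine good_of_adapted hn ?_ ?_ ?_
    · rw [FiringSystem.adapted_append]
      exact ⟨h1, (en_mid _).2 h2, trivial⟩
    · rw [FiringSystem.run_append, FiringSystem.run, FiringSystem.run, fire_mid]
    · rwa [wordP_append, wordP_mid_cons, wordP_nil, List.append_nil, hu.1]

end TwistedAdapted

/-! ### The dictionary between classes and states -/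

open TwistedAdapted
theorem mainTheorem1 (n : ℕ) (hn : 1 ≤ n) :
    -- the twisted adapted cluster point consists of classes of reduced words of `w₀`
    (∀ w : Word (2 * n + 1), commClass w ∈ twistedCluster n → IsLongestWord w) ∧
    -- the classes of all Dynkin quivers of type `A_{2n}` form an `r`-cluster point
    (∀ d ∈ adaptedCluster (2 * n), rCluster d = adaptedCluster (2 * n)) ∧
    -- the number of twisted adapted classes
    (twistedCluster n).ncard = 2 ^ (2 * n) ∧
    -- `n + 1` is a source or a sink of each twisted adapted class, but not both
    (∀ c ∈ twistedCluster n, Xor (IsSource (mid n) c) (IsSink (mid n) c)) ∧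
    -- `P` induces a map between the two cluster points
    ∃ PP : twistedCluster n → adaptedCluster (2 * n),
      (∀ (w : Word (2 * n + 1)) (hw : commClass w ∈ twistedCluster n),
        (PP ⟨commClass w, hw⟩ : CommClass (2 * n)) = commClass (wordP n w)) ∧
      -- which is onto and two-to-one
      Function.Surjective PP ∧
      (∀ d : adaptedCluster (2 * n), {c : twistedCluster n | PP c = d}.ncard = 2) ∧
      -- the two preimages are distinguished by `n + 1` being a source or a sink
      (∀ d : adaptedCluster (2 * n),
        (∃! c : twistedCluster n, PP c = d ∧ IsSource (mid n) c.1) ∧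
        (∃! c : twistedCluster n, PP c = d ∧ IsSink (mid n) c.1)) ∧
      (∀ Q : DynkinQuiver (2 * n),
        (∃! c : twistedCluster n, Q.IsClassOf (PP c).1 ∧ IsSource (mid n) c.1) ∧
        (∃! c : twistedCluster n, Q.IsClassOf (PP c).1 ∧ IsSink (mid n) c.1)) ∧
      -- the preimages of `[Q]` by surgery on any reduced word of `w₀` adapted to `Q`
      (∀ (Q : DynkinQuiver (2 * n)) (w : Word (2 * n)), IsLongestWord w → Q.Adapted w →
        (∃ u, IsInsertion n w u) ∧
        (∀ u u', IsInsertion n w u → IsInsertion n w u' → commClass u = commClass u') ∧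
        (∀ u, IsInsertion n w u →
          commClass (mid n :: u) ≠ commClass (u ++ [mid n]) ∧
          ∀ c : CommClass (2 * n + 1),
            (∃ hc : c ∈ twistedCluster n, (PP ⟨c, hc⟩).1 = commClass w) ↔
              c = commClass (mid n :: u) ∨ c = commClass (u ++ [mid n]))) := by
  -- `A` and `T` send a state to its unique class of good words; all assertions are translated into
  -- states through them.
  obtain ⟨A, hA⟩ := FiringSystem.exists_classes (exists_good hn)
  obtain ⟨T, hT⟩ := FiringSystem.exists_classes (F := twistedFiring n) fun s =>
    (exists_good_twisted hn s).imp fun _ h => h.1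
  have hAex (Q) : ∃ w, commClass w = A Q :=
    (exists_good hn Q).imp fun w hw => (hA Q w).1 hw
  have hTex (s) : ∃ w, commClass w = T s :=
    (exists_good_twisted hn s).imp fun w hw => (hT s w).1 hw.1
  have hclass (Q : DynkinQuiver (2 * n)) (c) : Q.IsClassOf c ↔ c = A Q := by
    rw [isClassOf_iff hn]
    constructor
    · rintro ⟨w, hw, rfl⟩
      exact (hA Q w).1 hw
    · rintro rfl
      obtain ⟨w, hw⟩ := hAex Q
      exact ⟨w, (hA Q w).2 hw, hw⟩
  have hmemA (c) : c ∈ adaptedCluster (2 * n) ↔ ∃ Q, c = A Q := exists_congr fun Q => hclass Q c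
  have hmemT (c) : c ∈ twistedCluster n ↔ ∃ s, c = T s := by
    rw [mem_twistedCluster_iff hn]
    refine exists_congr fun s => ⟨?_, ?_⟩
    · rintro ⟨w, hw, rfl⟩
      exact (hT s w).1 hw
    · rintro rfl
      obtain ⟨w, hw⟩ := hTex s
      exact ⟨w, (hT s w).2 hw, hw⟩
  have hTmem (s) : T s ∈ twistedCluster n := (hmemT _).2 ⟨s, rfl⟩
  have hAinj : Function.Injective A := fun Q R h => by
    obtain ⟨w, hw⟩ := hAex Q
    have h1 := (hA Q w).2 hw
    have h2 := (hA R w).2 (hw.trans h)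
    exact DynkinQuiver.eq_of_adapted h1.isLongestWord ((DynkinQuiver.adapted_iff _ _).2 h1.adapted)
      ((DynkinQuiver.adapted_iff _ _).2 h2.adapted)
  have hTinj : Function.Injective T := fun s t h => by
    obtain ⟨w, hw⟩ := hTex s
    exact twisted_eq_of_good ((hT s w).2 hw) ((hT t w).2 (hw.trans h))
      (isLongestWord_wordP hn (hTmem s) hw)
  have hsource (s) : IsSource (mid n) (T s) ↔ s.2 = false := by
    obtain ⟨w, hw⟩ := hTex s
    rw [← hw, isSource_mid_iff hn ((hT s w).2 hw)]
  have hsink (s) : IsSink (mid n) (T s) ↔ s.2 = true := by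
    obtain ⟨w, hw⟩ := hTex s
    rw [← hw, isSink_mid_iff ((hT s w).2 hw)]
  have hP (s w) (hw : commClass w = T s) : commClass (wordP n w) = A s.1 :=
    (hA _ _).1 (Good.wordP ((hT s w).2 hw) (isLongestWord_wordP hn (hTmem s) hw))
  -- On states the map is the projection `(Q, b) ↦ Q`; injectivity of `T` makes it well defined on
  -- classes.
  have hPP (c : twistedCluster n) : ∃ d : adaptedCluster (2 * n),
      ∀ s, c.1 = T s → d.1 = A s.1 := by
    obtain ⟨s, hs⟩ := (hmemT c.1).1 c.2
    refine ⟨⟨A s.1, (hmemA _).2 ⟨_, rfl⟩⟩, fun t ht => ?_⟩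
    rw [hTinj (hs.symm.trans ht)]
  choose PP hPP using hPP
  have hPPT (s) : (PP ⟨T s, hTmem s⟩).1 = A s.1 := hPP _ s rfl
  have hfib (Q : DynkinQuiver (2 * n)) (c : twistedCluster n) : (PP c).1 = A Q ↔
      c = ⟨T (Q, true), hTmem _⟩ ∨ c = ⟨T (Q, false), hTmem _⟩ := by
    obtain ⟨c, hc⟩ := c
    obtain ⟨⟨R, b⟩, rfl⟩ := (hmemT c).1 hc
    rw [hPPT, hAinj.eq_iff, Subtype.mk.injEq, Subtype.mk.injEq, hTinj.eq_iff, hTinj.eq_iff,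
      Prod.mk.injEq, Prod.mk.injEq, ← and_or_left]
    cases b <;> simp
  have hne (Q : DynkinQuiver (2 * n)) : T (Q, true) ≠ T (Q, false) := fun h => by
    simpa using hTinj h
  have huniq (Q : DynkinQuiver (2 * n)) :
      (∃! c : twistedCluster n, (PP c).1 = A Q ∧ IsSource (mid n) c.1) ∧
      (∃! c : twistedCluster n, (PP c).1 = A Q ∧ IsSink (mid n) c.1) := by
    constructor
    · refine ⟨⟨T (Q, false), hTmem _⟩, ⟨hPPT _, (hsource _).2 rfl⟩, ?_⟩
      rintro c ⟨h1, h2⟩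
      refine ((hfib Q c).1 h1).resolve_left ?_
      rintro rfl
      simpa using (hsource _).1 h2
    · refine ⟨⟨T (Q, true), hTmem _⟩, ⟨hPPT _, (hsink _).2 rfl⟩, ?_⟩
      rintro c ⟨h1, h2⟩
      refine ((hfib Q c).1 h1).resolve_right ?_
      rintro rfl
      simpa using (hsink _).1 h2
  refine ⟨?_, fun d hd => rCluster_eq_adaptedCluster hn hd, ?_, ?_, PP, ?_, ?_, ?_, ?_, ?_, ?_⟩
  · intro w hw
    obtain ⟨s, hs⟩ := (hmemT _).1 hw
    exact ((hT s w).2 hs).isLongestWord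
  · have hrange : twistedCluster n = Set.range T := by
      ext c
      rw [hmemT, Set.mem_range]
      exact exists_congr fun s => eq_comm
    -- Positivity of `n` provides a vertex, so that the `2 * n` vertices have `2 * n - 1` edges; the
    -- flag supplies the remaining factor 2.
    obtain ⟨k, rfl⟩ : ∃ k, n = k + 1 := ⟨n - 1, by omega⟩
    rw [hrange, ← Nat.card_coe_set_eq, Nat.card_range_of_injective hTinj, Nat.card_prod]
    change Nat.card (DynkinQuiver (2 * k + 1 + 1)) * _ = _
    rw [DynkinQuiver.card_eq, Nat.card_eq_fintype_card, Fintype.card_bool, ← pow_succ]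
    rfl
  · intro c hc
    obtain ⟨⟨Q, b⟩, rfl⟩ := (hmemT c).1 hc
    rw [hsource, hsink]
    cases b <;> simp [Xor]
  · intro w hw
    obtain ⟨s, hs⟩ := (hmemT _).1 hw
    rw [hP s w hs]
    exact hPP _ s hs
  · rintro ⟨d, hd⟩
    obtain ⟨Q, rfl⟩ := (hmemA d).1 hd
    exact ⟨⟨T (Q, true), hTmem _⟩, Subtype.ext (hPPT _)⟩
  · rintro ⟨d, hd⟩
    obtain ⟨Q, rfl⟩ := (hmemA d).1 hd
    have : {c : twistedCluster n | PP c = ⟨A Q, hd⟩} =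
        {⟨T (Q, true), hTmem _⟩, ⟨T (Q, false), hTmem _⟩} := by
      ext c
      exact Subtype.ext_iff.trans (hfib Q c)
    rw [this, Set.ncard_pair fun h => hne Q (Subtype.ext_iff.1 h)]
  · rintro ⟨d, hd⟩
    obtain ⟨Q, rfl⟩ := (hmemA d).1 hd
    simpa only [Subtype.ext_iff] using huniq Q
  · intro Q
    simpa only [hclass] using huniq Q
  · intro Q w hw hQ
    have hQ' := (DynkinQuiver.adapted_iff Q w).1 hQ
    have hwA : commClass w = A Q := (hclass Q _).1 ⟨w, hw, hQ, rfl⟩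
    refine ⟨⟨_, isInsertion_insertMid w⟩,
      fun u u' hu hu' => commClass_eq_of_isInsertion hn hw hQ' hu hu', fun u hu => ?_⟩
    obtain ⟨h1, h2⟩ := good_of_isInsertion hn hw hQ' hu
    -- The two completed words are good for `(Q, true)` and `(Q, false)`, the two states over `Q`.
    rw [(hT _ _).1 h1, (hT _ _).1 h2, hwA]
    refine ⟨hne Q, fun c => ?_⟩
    constructor
    · rintro ⟨hc, h⟩
      exact ((hfib Q ⟨c, hc⟩).1 h).imp (congrArg Subtype.val) (congrArg Subtype.val)
    · rintro (rfl | rfl)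
      · exact ⟨hTmem _, hPPT _⟩
      · exact ⟨hTmem _, hPPT _⟩
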